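/- **Definitions.** Let $[A,B]=AB-BA$. A tuple $(S_1,\dots,S_n)$ of bounded operators on a complex Hilbert space is hyponormal if the operator matrix $([S_j^*,S_i])_{i,j}$ is positive. An operator is subnormal if it is the restriction of a normal operator to an invariant subspace. Let $\mathfrak H_0$ be the class of commuting pairs $(T_1,T_2)$ of subnormal operators, and for $k\ge 1$ let $\mathfrak H_k$ be the class of pairs in $\mathfrak H_0$ that are $k$-hyponormal, i.e. for which the tuple of all $T_2^qT_1^p$ with $1\le p+q\le k$ is hyponormal. For $0<\kappa<1$ put $x_0=\kappa\sqrt{3/4}$, $x_n=\frac{\sqrt{(n+1)(n+3)}}{n+2}$ $(n\ge1)$ and $a=\sqrt{1/2}$. Let $W=W_{(\alpha,\beta)}=(T_1,T_2)$ be the $2$-variable weighted shift on $\ell^2(\mathbb Z_+^2)$, $T_1e_{\mathbf k}=\alpha_{\mathbf k}e_{\mathbf k+(1,0)}$, $T_2e_{\mathbf k}=\beta_{\mathbf k}e_{\mathbf k+(0,1)}$, with weights $$\alpha_{(n,0)}=x_n,\quad \alpha_{(0,m)}=a,\quad \alpha_{(n,m)}=1\quad(n,m\ge1),$$ $$\beta_{(0,0)}=\kappa,\quad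 \beta_{(n,0)}=\frac{a\kappa}{x_0x_1\cdots x_{n-1}}\ (n\ge1),\quad \beta_{(n,m)}=1\ (n\ge0,\ m\ge1).$$ Write $W^{(h,\ell)}=(T_1^h,T_2^\ell)$. Let $b(1,h)=\frac{2h+1}{(h+1)^2}$, $b(k,h)=\left[b(k-1,h)+\frac{2kh+1}{(kh)^2}\right]\left(\frac{kh}{kh+1}\right)^2$ for $k\ge2$, and $G(h)=\frac{2h^3+7h^2+8h+3}{2h^3+7h^2+10h+4}$ (so $G(2)=\frac{63}{68}$). **Theorem.** Let $0<\kappa<1$. 1. ($k=1$) $W^{(h,\ell)}\in\mathfrak H_1$ for all $h\ge2$, $\ell\ge1$, but $W\notin\mathfrak H_1$, if and only if $\sqrt{\frac{20}{23}}<\kappa\le\sqrt{\frac{63}{68}}$. For each individual $h\ge2$, $\ell\ge1$: $W^{(h,\ell)}\in\mathfrak H_1$ but $W\notin\mathfrak H_1$ if and only if $\sqrt{\frac{20}{23}}<\kappa\le\sqrt{G(h)}$. 2. ($k\ge2$) For each $h\ge2$, $\ell\ge1$: $W^{(h,\ell)}\in\mathfrak H_k$ but $W\notin\mathfrak H_k$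 if and only if $\sqrt{\frac{2(k+1)^2}{3k^2+6k+2}}<\kappa\le\sqrt{\frac{2}{2+b(k,h)}}$. Consequently, for every $k\ge1$ there is $\kappa\in(0,1)$ such that $W\in\mathfrak H_0\setminus\mathfrak H_k$ and $W^{(h,\ell)}\in\mathfrak H_k$ for all $h\ge2$, $\ell\ge1$; that is, $k$-hyponormality of all powers $W^{(h,\ell)}$ with $h\ge2$, $\ell\ge1$ does not imply $k$-hyponormality of $W$. -/

import Mathlib

open scoped ComplexOrder

/-! ### Subnormality, hyponormality of tuples, and the classes of commuting pairs -/

section Classes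

universe u v

variable {H : Type u} [NormedAddCommGroup H] [InnerProductSpace ℂ H] [CompleteSpace H]

/-- A bounded operator `T` is subnormal if it is (up to an isometric identification of `H` with a
closed subspace of `K`) the restriction of a normal operator `N` on a Hilbert space `K` to an
invariant subspace. -/
def IsSubnormalOperator (T : H →L[ℂ] H) : Prop :=
  ∃ (K : Type u) (_ : NormedAddCommGroup K) (_ : InnerProductSpace ℂ K) (_ : CompleteSpace K)
    (N : K →L[ℂ] K) (V : H →ₗᵢ[ℂ] K), IsStarNormal N ∧ ∀ x : H, N (V x) = V (T x)

/-- An operator matrix `M` over a finite index set `ι` is positive on the direct sum of `ι` copies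
of `H`: its quadratic form `⟨M v, v⟩` is real and nonnegative for every `v`. -/
def OperatorMatrixPositive {ι : Type v} [Fintype ι] (M : Matrix ι ι (H →L[ℂ] H)) : Prop :=
  ∀ v : ι → H, 0 ≤ ∑ i, ∑ j, inner ℂ (v i) (M i j (v j))

/-- A finite tuple `S` of operators is (jointly) hyponormal if the operator matrix with `(i, j)`
entry the commutator `[S_j*, S_i] = S_j* S_i - S_i S_j*` is positive. -/
def IsJointlyHyponormal {ι : Type v} [Fintype ι] (S : ι → (H →L[ℂ] H)) : Prop :=
  OperatorMatrixPositive (Matrix.of fun i j : ι =>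
    ContinuousLinearMap.adjoint (S j) * S i - S i * ContinuousLinearMap.adjoint (S j))

/-- The exponents `(p, q)` with `1 ≤ p + q ≤ k`. -/
def exponentsUpTo (k : ℕ) : Finset (ℕ × ℕ) :=
  (Finset.range (k + 1) ×ˢ Finset.range (k + 1)).filter
    fun p => 1 ≤ p.1 + p.2 ∧ p.1 + p.2 ≤ k

/-- The pair `(T₁, T₂)` is `k`-hyponormal if the tuple of all monomials `T₂ ^ q T₁ ^ p` with
`1 ≤ p + q ≤ k` is hyponormal. (To be used for commuting pairs.) -/
def IsKHyponormal (k : ℕ) (T₁ T₂ : H →L[ℂ] H) : Prop :=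
  IsJointlyHyponormal fun p : exponentsUpTo k => T₂ ^ p.1.2 * T₁ ^ p.1.1

/-- The class of commuting pairs of subnormal operators. -/
def ClassH0 (T₁ T₂ : H →L[ℂ] H) : Prop :=
  Commute T₁ T₂ ∧ IsSubnormalOperator T₁ ∧ IsSubnormalOperator T₂

/-- The class of `k`-hyponormal pairs among the commuting pairs of subnormal operators
(used for `k ≥ 1`). -/
def ClassH (k : ℕ) (T₁ T₂ : H →L[ℂ] H) : Prop :=
  ClassH0 T₁ T₂ ∧ IsKHyponormal k T₁ T₂

end Classes

/-! ### Weighted shifts -/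

section Shifts

/-- The Hilbert space `ℓ²(ι)` of square-summable complex families. -/
abbrev Ell2 (ι : Type) : Type := lp (fun _ : ι => ℂ) 2

theorem memℓp_extend {ι : Type} {σ : ι → ι} (hσ : Function.Injective σ) {w : ι → ℝ} {C : ℝ}
    (hC : ∀ i, |w i| ≤ C) (f : Ell2 ι) :
    Memℓp (Function.extend σ (fun i => (w i : ℂ) * f i) 0 : ι → ℂ) 2 ∧
      ∑' j, ‖(Function.extend σ (fun i => (w i : ℂ) * f i) 0 : ι → ℂ) j‖ ^ (2 : ℝ)
        ≤ ∑' i, C ^ 2 * ‖f i‖ ^ (2 : ℝ) := by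
  have hf : Summable fun i => ‖f i‖ ^ (2 : ℝ) := by
    simpa using (lp.memℓp f).summable (by norm_num)
  have hle : ∀ i, ‖(w i : ℂ) * f i‖ ^ (2 : ℝ) ≤ C ^ 2 * ‖f i‖ ^ (2 : ℝ) := by
    intro i
    have h0 : |w i| ^ 2 ≤ C ^ 2 := pow_le_pow_left₀ (abs_nonneg _) (hC i) 2
    have h1 : ‖(w i : ℂ) * f i‖ ^ (2 : ℝ) = |w i| ^ 2 * ‖f i‖ ^ (2 : ℝ) := by
      rw [norm_mul, Complex.norm_real, Real.norm_eq_abs]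
      norm_cast
      rw [mul_pow]
    rw [h1]
    gcongr
  have hs : Summable fun i => ‖(w i : ℂ) * f i‖ ^ (2 : ℝ) :=
    Summable.of_nonneg_of_le (fun i => by positivity) hle (hf.mul_left _)
  have hcomp : (fun j => ‖(Function.extend σ (fun i => (w i : ℂ) * f i) 0 : ι → ℂ) j‖ ^ (2 : ℝ)) ∘ σ
      = fun i => ‖(w i : ℂ) * f i‖ ^ (2 : ℝ) := by
    funext i
    simp [hσ.extend_apply]
  have hzero : ∀ j, j ∉ Set.range σ →
      ‖(Function.extend σ (fun i => (w i : ℂ) * f i) 0 : ι → ℂ) j‖ ^ (2 : ℝ) = 0 := by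
    intro j hj
    rw [Function.extend_apply' _ _ _ (by simpa using hj)]
    simp
  refine ⟨(memℓp_gen_iff (by norm_num)).2 ?_, ?_⟩
  · have := (hσ.summable_iff hzero).1 (by rw [hcomp]; exact hs)
    simpa using this
  · rw [← hσ.tsum_eq (Function.support_subset_iff'.2 hzero)]
    have h2 : ∀ i, ‖(Function.extend σ (fun i => (w i : ℂ) * f i) 0 : ι → ℂ) (σ i)‖ ^ (2 : ℝ)
        = ‖(w i : ℂ) * f i‖ ^ (2 : ℝ) := fun i => congrFun hcomp i
    simp_rw [h2]
    exact hs.tsum_le_tsum hle (hf.mul_left _)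

/-- The bounded operator on `ℓ²(ι)` that sends the basis vector `e_i` to `w_i e_{σ i}`, for an
injective map `σ` and bounded real weights `w`. On a family `f` it acts by
`(S f)_{σ i} = w_i f_i`, and `(S f)_j = 0` for `j` outside the range of `σ`. -/
noncomputable def injectionShift {ι : Type} (σ : ι → ι) (hσ : Function.Injective σ) (w : ι → ℝ)
    (hw : ∃ C, ∀ i, |w i| ≤ C) : Ell2 ι →L[ℂ] Ell2 ι :=
  LinearMap.mkContinuousOfExistsBound
    { toFun := fun f =>
        ⟨Function.extend σ (fun i => (w i : ℂ) * f i) 0,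
          (memℓp_extend hσ hw.choose_spec f).1⟩
      map_add' := by
        intro f g
        ext j
        change Function.extend σ (fun i => (w i : ℂ) * (f i + g i)) 0 j
          = Function.extend σ (fun i => (w i : ℂ) * f i) 0 j
            + Function.extend σ (fun i => (w i : ℂ) * g i) 0 j
        by_cases hj : ∃ i, σ i = j
        · obtain ⟨i, rfl⟩ := hj
          simp only [hσ.extend_apply, mul_add]
        · simp [Function.extend_apply' _ _ _ hj]
      map_smul' := by
        intro c f
        ext j
        by_cases hj : ∃ i, σ i = j
        · obtain ⟨i, rfl⟩ := hj
          simp [hσ.extend_apply, mul_left_comm]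
        · simp [Function.extend_apply' _ _ _ hj] }
    (by
      obtain ⟨C, hC⟩ := hw
      refine ⟨|C|, fun f => ?_⟩
      have hp : 0 < (2 : ENNReal).toReal := by norm_num
      have h1 := (memℓp_extend hσ hC f).2
      refine lp.norm_le_of_tsum_le hp (by positivity) ?_
      have h3 : (|C| * ‖f‖) ^ (2 : ENNReal).toReal = ∑' i, C ^ 2 * ‖f i‖ ^ (2 : ℝ) := by
        rw [Real.mul_rpow (abs_nonneg _) (norm_nonneg _), lp.norm_rpow_eq_tsum hp, tsum_mul_left]
        simp
      rw [h3]
      simpa using h1)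

theorem injectionShift_apply {ι : Type} (σ : ι → ι) (hσ : Function.Injective σ) (w : ι → ℝ)
    (hw : ∃ C, ∀ i, |w i| ≤ C) (f : Ell2 ι) (i : ι) :
    injectionShift σ hσ w hw f (σ i) = (w i : ℂ) * f i := by
  change Function.extend σ (fun i => (w i : ℂ) * f i) 0 (σ i) = _
  exact hσ.extend_apply _ _ _

theorem injectionShift_apply_of_notMem {ι : Type} (σ : ι → ι) (hσ : Function.Injective σ)
    (w : ι → ℝ) (hw : ∃ C, ∀ i, |w i| ≤ C) (f : Ell2 ι) {j : ι} (hj : ¬ ∃ i, σ i = j) :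
    injectionShift σ hσ w hw f j = 0 := by
  change Function.extend σ (fun i => (w i : ℂ) * f i) 0 j = _
  exact Function.extend_apply' _ _ _ hj

theorem injectionShift_single {ι : Type} [DecidableEq ι] (σ : ι → ι) (hσ : Function.Injective σ)
    (w : ι → ℝ) (hw : ∃ C, ∀ i, |w i| ≤ C) (i : ι) :
    injectionShift σ hσ w hw (lp.single 2 i (1 : ℂ)) = lp.single 2 (σ i) (w i : ℂ) := by
  ext j
  by_cases hj : ∃ i', σ i' = j
  · obtain ⟨i', rfl⟩ := hj
    rw [injectionShift_apply]
    by_cases h : i' = i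
    · subst h; simp
    · simp [lp.single_apply, h, hσ.eq_iff]
  · rw [injectionShift_apply_of_notMem _ _ _ _ _ hj]
    have h : j ≠ σ i := fun h => hj ⟨i, h.symm⟩
    simp [lp.single_apply, h]

/-- The first component `T₁ e_k = α_k e_{k + (1, 0)}` of a `2`-variable weighted shift. -/
noncomputable def shiftT1 (α : ℕ × ℕ → ℝ) (hα : ∃ C, ∀ p, |α p| ≤ C) :
    Ell2 (ℕ × ℕ) →L[ℂ] Ell2 (ℕ × ℕ) :=
  injectionShift (fun p => (p.1 + 1, p.2)) (fun p q h => by simpa [Prod.ext_iff] using h) α hα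

/-- The second component `T₂ e_k = β_k e_{k + (0, 1)}` of a `2`-variable weighted shift. -/
noncomputable def shiftT2 (β : ℕ × ℕ → ℝ) (hβ : ∃ C, ∀ p, |β p| ≤ C) :
    Ell2 (ℕ × ℕ) →L[ℂ] Ell2 (ℕ × ℕ) :=
  injectionShift (fun p => (p.1, p.2 + 1)) (fun p q h => by simpa [Prod.ext_iff] using h) β hβ

end Shifts

/-! ### The family of examples -/

section Family

/-- Horizontal weights of the diagram: `x₀, x₁, x₂, …` in the bottom row and `a, 1, 1, …` in every
other row. -/
def diagramAlpha (x : ℕ → ℝ) (a : ℝ) (p : ℕ × ℕ) : ℝ :=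
  if p.2 = 0 then x p.1 else if p.1 = 0 then a else 1

/-- Vertical weights of the diagram: `y, a y / x₀, a y / (x₀ x₁), …` out of the bottom row, and `1`
everywhere else. -/
noncomputable def diagramBeta (x : ℕ → ℝ) (a y : ℝ) (p : ℕ × ℕ) : ℝ :=
  if p.2 = 0 then
    if p.1 = 0 then y else a * y / ∏ i ∈ Finset.range p.1, x i
  else 1

/-- The weights `x₀ = κ √(3/4)` and `xₙ = √((n+1)(n+3)) / (n+2)` for `n ≥ 1`. -/
noncomputable def xWeight (κ : ℝ) (n : ℕ) : ℝ :=
  if n = 0 then κ * √(3 / 4) else √(((n : ℝ) + 1) * ((n : ℝ) + 3)) / ((n : ℝ) + 2)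

theorem prod_xWeight (κ : ℝ) (n : ℕ) :
    ∏ i ∈ Finset.range (n + 1), xWeight κ i = κ * √(((n : ℝ) + 3) / (2 * ((n : ℝ) + 2))) := by
  induction n with
  | zero => norm_num [xWeight]
  | succ n ih =>
    rw [Finset.prod_range_succ, ih, mul_assoc]
    congr 1
    have h2 : (0 : ℝ) < (n : ℝ) + 1 + 2 := by positivity
    simp only [xWeight, Nat.succ_ne_zero, if_false]
    push_cast
    rw [← Real.sqrt_sq h2.le, ← Real.sqrt_div (by positivity), ← Real.sqrt_mul (by positivity),
      Real.sqrt_sq h2.le]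
    congr 1
    field_simp
    ring

/-- The horizontal weights of the shift with parameter `κ`. -/
noncomputable def alphaW (κ : ℝ) : ℕ × ℕ → ℝ := diagramAlpha (xWeight κ) (1 / √2)

/-- The vertical weights of the shift with parameter `κ` (so `y = κ`). -/
noncomputable def betaW (κ : ℝ) : ℕ × ℕ → ℝ := diagramBeta (xWeight κ) (1 / √2) κ

theorem alphaW_bounded (κ : ℝ) : ∃ C, ∀ p, |alphaW κ p| ≤ C := by
  refine ⟨|κ| + 1, fun ⟨m, n⟩ => ?_⟩
  have hk := abs_nonneg κ
  simp only [alphaW, diagramAlpha, xWeight]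
  split_ifs with h1 h2 h3
  · rw [abs_mul, abs_of_nonneg (Real.sqrt_nonneg _)]
    have : √(3 / 4 : ℝ) ≤ 1 := Real.sqrt_le_one.2 (by norm_num)
    nlinarith
  · rw [abs_of_nonneg (by positivity)]
    have : √(((m : ℝ) + 1) * ((m : ℝ) + 3)) / ((m : ℝ) + 2) ≤ 1 := by
      rw [div_le_one (by positivity)]
      exact Real.sqrt_le_iff.2 ⟨by positivity, by nlinarith⟩
    linarith
  · rw [abs_of_nonneg (by positivity)]
    have : 1 / √(2 : ℝ) ≤ 1 := by
      rw [div_le_one (by positivity)]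
      exact Real.one_le_sqrt.2 (by norm_num)
    linarith
  · simp

theorem betaW_bounded (κ : ℝ) : ∃ C, ∀ p, |betaW κ p| ≤ C := by
  refine ⟨|κ| + 1, fun ⟨m, n⟩ => ?_⟩
  have hk := abs_nonneg κ
  simp only [betaW, diagramBeta]
  split_ifs with h1 h2
  · linarith
  · obtain ⟨m, rfl⟩ := Nat.exists_eq_succ_of_ne_zero h2
    rw [Nat.succ_eq_add_one, prod_xWeight]
    have hs : 1 / √(2 : ℝ) ≤ √(((m : ℝ) + 3) / (2 * ((m : ℝ) + 2))) := by
      rw [one_div, ← Real.sqrt_inv]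
      apply Real.sqrt_le_sqrt
      rw [inv_eq_one_div, div_le_div_iff₀ (by norm_num) (by positivity)]
      nlinarith
    have hpos : 0 < √(((m : ℝ) + 3) / (2 * ((m : ℝ) + 2))) := Real.sqrt_pos.2 (by positivity)
    rcases eq_or_ne κ 0 with rfl | h0
    · simp
    · have : 1 / √(2 : ℝ) * κ / (κ * √(((m : ℝ) + 3) / (2 * ((m : ℝ) + 2))))
          = 1 / √(2 : ℝ) / √(((m : ℝ) + 3) / (2 * ((m : ℝ) + 2))) := by
        field_simp
      rw [this, abs_of_nonneg (by positivity)]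
      have := (div_le_one hpos).2 hs
      linarith
  · simp

/-- First component of the `2`-variable weighted shift with parameter `κ`. -/
noncomputable def shiftW1 (κ : ℝ) : Ell2 (ℕ × ℕ) →L[ℂ] Ell2 (ℕ × ℕ) :=
  shiftT1 (alphaW κ) (alphaW_bounded κ)

/-- Second component of the `2`-variable weighted shift with parameter `κ`. -/
noncomputable def shiftW2 (κ : ℝ) : Ell2 (ℕ × ℕ) →L[ℂ] Ell2 (ℕ × ℕ) :=
  shiftT2 (betaW κ) (betaW_bounded κ)

/-- The sequence `b(1,h) = (2h+1)/(h+1)²`,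
`b(k,h) = (b(k-1,h) + (2kh+1)/(kh)²) (kh/(kh+1))²` for `k ≥ 2`; the value at `k = 0` is not used. -/
noncomputable def bSeq : ℕ → ℝ → ℝ
  | 0, _ => 0
  | 1, h => (2 * h + 1) / (h + 1) ^ 2
  | (k + 2), h =>
    (bSeq (k + 1) h + (2 * ((k : ℝ) + 2) * h + 1) / (((k : ℝ) + 2) * h) ^ 2) *
      (((k : ℝ) + 2) * h / (((k : ℝ) + 2) * h + 1)) ^ 2

/-- The rational function `G(h) = (2h³+7h²+8h+3)/(2h³+7h²+10h+4)`. -/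
noncomputable def gFun (h : ℝ) : ℝ :=
  (2 * h ^ 3 + 7 * h ^ 2 + 8 * h + 3) / (2 * h ^ 3 + 7 * h ^ 2 + 10 * h + 4)

end Family

/-! ### A normal model: multiplication operators over the unit square times a torus. -/

section Model

open MeasureTheory ComplexConjugate unitInterval

/-! Let `γ_p` be the moments of `W`. On the vectors `√γ_p e_p` both shifts act without weights. The
`γ_p` are the moments of `κ²/2 (δ_(1,1) + δ_(0,1) + dx × δ₀)` plus the mass `1 - 3κ²/2` at the
origin. This mass is negative for `κ² > 2/3`, so `W` then fails to come from a positive measure,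
although each row and each column does; hence `W` stays in `ClassH0` for all `κ < 1`.

The only defect sits at `e₀`: apart from a rank-one correction there, `W` is modelled by commuting
normal multiplication operators (`exists_modelMap`). By an orthogonal projection in the model
(`momentForm_le`), `k`-hyponormality of `(T₁ʰ, T₂ˡ)` reduces to positivity of a single moment
matrix, the one based at the origin.

The form of that matrix is `κ²/2 (|Σ d|² + |Σ_{p=0} d|² + H(d)) + (1 - 3κ²/2)|d₀|²`, where `H` is
the Gram form of `t^(hn)`, `0 ≤ n ≤ k`, in `L²(0,1)`. It does not depend on `l`. For `k ≥ 2` the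
exponents `(0,1)` and `(1,1)` are free to annihilate both squares, so only the minimum of `H` under
`d₀ = 1` matters. This is the Müntz distance `∏ (hj/(hj+1))²`, computed by Schur complements of a
Cauchy-type matrix, and it equals `1 - b(k,h)`. For `k = 1` the exponent `(1,1)` is absent, the two
squares cannot both be removed, and completing squares gives `G(h)` instead. Both thresholds
increase with `h`, so passing from `h = 1` to `h ≥ 2` opens a gap. -/

/-- The measure `δ_(0,1) + δ_(1,1) + dx × δ₀` on the unit square. -/
noncomputable def squareMeasure : Measure (I × I) :=
  Measure.dirac (0, 1) + Measure.dirac (1, 1) + Measure.map (fun x : I => (x, (0 : I))) volume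

instance : IsFiniteMeasure squareMeasure := by
  unfold squareMeasure
  infer_instance

/-- Integration of real functions on the unit square against `squareMeasure`. -/
noncomputable def squareIntegral (ψ : C(I × I, ℝ)) : ℝ :=
  ψ (0, 1) + ψ (1, 1) + ∫ x : I, ψ (x, 0)

theorem integral_squareMeasure (ψ : C(I × I, ℝ)) :
    ∫ x, ψ x ∂squareMeasure = squareIntegral ψ := by
  have hint : ∀ (m : Measure (I × I)) [IsFiniteMeasure m], Integrable (fun x => ψ x) m :=
    fun m _ => BoundedContinuousFunction.integrable m (BoundedContinuousFunction.mkOfCompact ψ)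
  unfold squareMeasure squareIntegral
  rw [integral_add_measure (hint _) (hint _), integral_add_measure (hint _) (hint _),
    integral_dirac, integral_dirac, integral_map (by fun_prop) (by fun_prop)]

/-- The product of the unit square with a two-dimensional torus. -/
abbrev TorusBundle : Type := (I × I) × (UnitAddCircle × UnitAddCircle)

/-- `squareMeasure` times the Haar measure of the torus. -/
noncomputable def bundleMeasure : Measure TorusBundle :=
  squareMeasure.prod (AddCircle.haarAddCircle.prod AddCircle.haarAddCircle)

instance : IsFiniteMeasure bundleMeasure := by
  unfold bundleMeasure
  infer_instance

theorem integrable_bundleMeasure (a : C(TorusBundle, ℂ)) :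
    Integrable (fun x => a x) bundleMeasure :=
  BoundedContinuousFunction.integrable _ (BoundedContinuousFunction.mkOfCompact a)

/-- Integration against `bundleMeasure` as a positive functional. -/
noncomputable def bundleState : C(TorusBundle, ℂ) →ₚ[ℂ] ℂ :=
  PositiveLinearMap.mk₀
    { toFun := fun a => ∫ x, a x ∂bundleMeasure
      map_add' := fun a b => integral_add (integrable_bundleMeasure a) (integrable_bundleMeasure b)
      map_smul' := fun c _ => integral_const_mul c _ }
    (fun _ ha => integral_nonneg fun x => ha x)

theorem bundleState_apply (a : C(TorusBundle, ℂ)) : bundleState a = ∫ x, a x ∂bundleMeasure := rfl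

/-- The function `ψ(s, t) z₁ⁿ z₂ᵐ`. -/
noncomputable def torusMonomial (ψ : C(I × I, ℝ)) (n m : ℤ) : C(TorusBundle, ℂ) where
  toFun x := (ψ x.1 : ℂ) * (fourier n x.2.1 * fourier m x.2.2)
  continuous_toFun := by fun_prop

theorem torusMonomial_apply (ψ : C(I × I, ℝ)) (n m : ℤ) (x : TorusBundle) :
    torusMonomial ψ n m x = (ψ x.1 : ℂ) * (fourier n x.2.1 * fourier m x.2.2) := rfl

theorem torusMonomial_mul (ψ ψ' : C(I × I, ℝ)) (n m n' m' : ℤ) :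
    torusMonomial ψ n m * torusMonomial ψ' n' m' = torusMonomial (ψ * ψ') (n + n') (m + m') := by
  ext x
  simp only [ContinuousMap.mul_apply, torusMonomial_apply, fourier_add, Complex.ofReal_mul]
  ring

theorem torusMonomial_star (ψ : C(I × I, ℝ)) (n m : ℤ) :
    star (torusMonomial ψ n m) = torusMonomial ψ (-n) (-m) := by
  ext x
  simp only [ContinuousMap.star_apply, torusMonomial_apply, fourier_neg, star_mul',
    RCLike.star_def, Complex.conj_ofReal]

theorem torusMonomial_smul (c : ℝ) (ψ : C(I × I, ℝ)) (n m : ℤ) :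
    torusMonomial (c • ψ) n m = (c : ℂ) • torusMonomial ψ n m := by
  ext x
  simp [torusMonomial_apply, mul_assoc]

theorem integral_fourier_haar (n : ℤ) :
    ∫ x : UnitAddCircle, fourier n x ∂AddCircle.haarAddCircle = if n = 0 then 1 else 0 := by
  have h := orthonormal_iff_ite.1 (orthonormal_fourier (T := 1)) 0 n
  rw [ContinuousMap.inner_toLp (𝕜 := ℂ) (@AddCircle.haarAddCircle 1 _) (fourier 0) (fourier n)] at h
  simpa [eq_comm] using h

theorem bundleState_torusMonomial (ψ : C(I × I, ℝ)) (n m : ℤ) :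
    bundleState (torusMonomial ψ n m) = if n = 0 ∧ m = 0 then (squareIntegral ψ : ℂ) else 0 := by
  rw [bundleState_apply]
  simp only [torusMonomial_apply, bundleMeasure]
  rw [integral_prod_mul (fun p : I × I => (ψ p : ℂ))
    (fun z : UnitAddCircle × UnitAddCircle => (fourier n z.1 * fourier m z.2 : ℂ)),
    integral_prod_mul (fun z : UnitAddCircle => (fourier n z : ℂ)) (fun z => fourier m z),
    integral_fourier_haar, integral_fourier_haar, integral_complex_ofReal, integral_squareMeasure]
  split_ifs <;> simp_all

/-- The Hilbert space on which the functions of `TorusBundle` act by multiplication. -/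
abbrev ModelSpace : Type := bundleState.GNS

/-- The vector given by the function `ψ(s, t) z₁ⁿ z₂ᵐ` for `p = (n, m)`. -/
noncomputable def modelVec (ψ : C(I × I, ℝ)) (p : ℕ × ℕ) : ModelSpace :=
  (bundleState.toPreGNS (torusMonomial ψ p.1 p.2) : ModelSpace)

/-- Multiplication by `ψ(s, t) z₁ⁿ z₂ᵐ` for `p = (n, m)`. -/
noncomputable def modelOp (ψ : C(I × I, ℝ)) (p : ℕ × ℕ) : ModelSpace →L[ℂ] ModelSpace :=
  bundleState.gnsStarAlgHom (torusMonomial ψ p.1 p.2)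

theorem modelOp_modelVec (ψ ψ' : C(I × I, ℝ)) (p q : ℕ × ℕ) :
    modelOp ψ p (modelVec ψ' q) = modelVec (ψ * ψ') (p + q) := by
  refine (bundleState.gnsNonUnitalStarAlgHom_apply_coe
    (a := torusMonomial ψ p.1 p.2)).trans ?_
  rw [PositiveLinearMap.leftMulMapPreGNS_apply]
  simp [torusMonomial_mul, modelVec]

/-- The torus characters make vectors of different degree orthogonal, as the basis vectors of `ℓ²`
are; within one degree only the integral over the square remains. -/
theorem inner_modelVec (ψ ψ' : C(I × I, ℝ)) (p q : ℕ × ℕ) :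
    inner ℂ (modelVec ψ p) (modelVec ψ' q) =
      if p = q then (squareIntegral (ψ * ψ') : ℂ) else 0 := by
  rw [modelVec, modelVec, UniformSpace.Completion.inner_coe, PositiveLinearMap.preGNS_inner_def]
  simp only [PositiveLinearMap.ofPreGNS_toPreGNS, torusMonomial_star, torusMonomial_mul,
    bundleState_torusMonomial]
  congr 1
  simp only [Prod.ext_iff, eq_iff_iff]
  omega

theorem modelVec_smul (c : ℝ) (ψ : C(I × I, ℝ)) (p : ℕ × ℕ) :
    modelVec (c • ψ) p = (c : ℂ) • modelVec ψ p := by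
  rw [modelVec, modelVec, torusMonomial_smul, map_smul, UniformSpace.Completion.coe_smul]

theorem adjoint_modelOp_mul (ψ ψ' : C(I × I, ℝ)) (p q : ℕ × ℕ) :
    ContinuousLinearMap.adjoint (modelOp ψ p) * modelOp ψ' q =
      modelOp ψ' q * ContinuousLinearMap.adjoint (modelOp ψ p) := by
  rw [← ContinuousLinearMap.star_eq_adjoint, modelOp, modelOp, ← map_star, ← map_mul, ← map_mul,
    mul_comm]

/-- Normality in the form used later: the operators commute with each other's adjoints, so a cross
term becomes an inner product of adjoint images, and a double sum of such terms becomes a single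
squared norm. -/
theorem inner_modelOp_modelOp (ψ ψ' : C(I × I, ℝ)) (p q : ℕ × ℕ) (x y : ModelSpace) :
    inner ℂ (modelOp ψ p x) (modelOp ψ' q y) =
      inner ℂ (ContinuousLinearMap.adjoint (modelOp ψ' q) x)
        (ContinuousLinearMap.adjoint (modelOp ψ p) y) := by
  rw [← ContinuousLinearMap.adjoint_inner_right, ContinuousLinearMap.adjoint_inner_left]
  exact congrArg (inner ℂ x) (DFunLike.congr_fun (adjoint_modelOp_mul ψ ψ' p q) y)

theorem isStarNormal_modelOp (ψ : C(I × I, ℝ)) (p : ℕ × ℕ) : IsStarNormal (modelOp ψ p) :=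
  ⟨adjoint_modelOp_mul ψ ψ p p⟩

end Model

/-! ### Subnormality of weighted shifts through the model. -/

section Subnormal

open MeasureTheory unitInterval

theorem ell2_clm_ext {ι : Type} [DecidableEq ι] {F : Type*} [AddCommMonoid F] [Module ℂ F]
    [TopologicalSpace F] [T2Space F] {f g : Ell2 ι →L[ℂ] F}
    (h : ∀ i, f (lp.single 2 i (1 : ℂ)) = g (lp.single 2 i (1 : ℂ))) : f = g := by
  refine lp.ext_continuousLinearMap (by norm_num) fun i => ?_
  ext
  simpa using h i

theorem ell2_single_smul {ι : Type} [DecidableEq ι] (i : ι) (c : ℂ) :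
    (lp.single 2 i c : Ell2 ι) = c • lp.single 2 i (1 : ℂ) := by
  rw [← lp.single_smul, smul_eq_mul, mul_one]

/-- A weighted shift whose moments along each orbit are given by functions in the torus model is
subnormal. -/
theorem isSubnormalOperator_injectionShift {τ : ℕ × ℕ → ℕ × ℕ} (hτ : Function.Injective τ)
    {w : ℕ × ℕ → ℝ} (hw : ∃ C, ∀ i, |w i| ≤ C) {g : ℕ × ℕ → ℝ} (hg : ∀ p, 0 < g p)
    {ψ : ℕ × ℕ → C(I × I, ℝ)} {χ : C(I × I, ℝ)} {e : ℕ × ℕ} (hτe : ∀ p, τ p = e + p)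
    (hψ : ∀ p, squareIntegral (ψ p * ψ p) = g p) (hχ : ∀ p, χ * ψ p = ψ (τ p))
    (hwg : ∀ p, w p * √(g p) = √(g (τ p))) :
    IsSubnormalOperator (injectionShift τ hτ w hw) := by
  have hs : ∀ p, √(g p) ≠ 0 := fun p => (Real.sqrt_pos.2 (hg p)).ne'
  -- The images of the basis vectors. They are orthonormal by degree, and multiplication by `χ z^e`
  -- moves them exactly as the shift moves the basis.
  set u : ℕ × ℕ → ModelSpace := fun p => modelVec ((√(g p))⁻¹ • ψ p) p with hu
  have hon : Orthonormal ℂ u := by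
    rw [orthonormal_iff_ite]
    intro p q
    simp only [hu, modelVec_smul, inner_smul_left, inner_smul_right, inner_modelVec]
    split_ifs with h
    · subst h
      rw [hψ, Complex.conj_ofReal]
      norm_cast
      have := Real.mul_self_sqrt (hg p).le
      rw [← this]
      field_simp [hs p]
      simp [Real.sqrt_sq]
    · simp
  refine ⟨ModelSpace, inferInstance, inferInstance, inferInstance, modelOp χ e,
    hon.orthogonalFamily.linearIsometry, isStarNormal_modelOp _ _, ?_⟩
  have key : (modelOp χ e).comp hon.orthogonalFamily.linearIsometry.toContinuousLinearMap =
      hon.orthogonalFamily.linearIsometry.toContinuousLinearMap.comp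
        (injectionShift τ hτ w hw) := by
    refine ell2_clm_ext fun p => ?_
    simp only [ContinuousLinearMap.comp_apply, LinearIsometry.coe_toContinuousLinearMap,
      injectionShift_single, OrthogonalFamily.linearIsometry_apply_single,
      LinearIsometry.toSpanSingleton_apply, one_smul]
    simp only [hu, modelVec_smul, map_smul, modelOp_modelVec, smul_smul, hχ, ← hτe]
    congr 1
    norm_cast
    rw [← hwg]
    have := hs (τ p)
    rw [← hwg] at this
    field_simp [hs p, left_ne_zero_of_mul this]
  exact fun x => DFunLike.congr_fun key x

theorem isSubnormalOperator_pow {H : Type*} [NormedAddCommGroup H] [InnerProductSpace ℂ H]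
    [CompleteSpace H] {T : H →L[ℂ] H} (hT : IsSubnormalOperator T) (n : ℕ) :
    IsSubnormalOperator (T ^ n) := by
  obtain ⟨K, i1, i2, i3, N, V, hN, hV⟩ := hT
  refine ⟨K, i1, i2, i3, N ^ n, V, ⟨by
    rw [star_pow]; exact hN.star_comm_self.pow_pow n n⟩, ?_⟩
  induction n with
  | zero => simp
  | succ n ih =>
    intro x
    rw [pow_succ, pow_succ, mul_apply_eq_comp, hV, ih, mul_apply_eq_comp]

theorem classH0_pow {H : Type*} [NormedAddCommGroup H] [InnerProductSpace ℂ H]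
    [CompleteSpace H] {T₁ T₂ : H →L[ℂ] H} (hT : ClassH0 T₁ T₂) (n m : ℕ) :
    ClassH0 (T₁ ^ n) (T₂ ^ m) :=
  ⟨hT.1.pow_pow n m, isSubnormalOperator_pow hT.2.1 n, isSubnormalOperator_pow hT.2.2 m⟩

end Subnormal

/-! ### Moments of the shift. -/

section Moments

/-- The moments of the shift with parameter `κ` that come from the positive measure
`κ²/2 (δ_(1,1) + δ_(0,1) + dx × δ₀)`. -/
noncomputable def posMoment (κ : ℝ) (p : ℕ × ℕ) : ℝ :=
  κ ^ 2 / 2 * (1 + (if p.1 = 0 then 1 else 0) + if p.2 = 0 then 1 / ((p.1 : ℝ) + 1) else 0)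

/-- The moments of the shift with parameter `κ`. -/
noncomputable def momentW (κ : ℝ) (p : ℕ × ℕ) : ℝ :=
  posMoment κ p + if p = 0 then 1 - 3 / 2 * κ ^ 2 else 0

theorem momentW_zero (κ : ℝ) : momentW κ 0 = 1 := by
  norm_num [momentW, posMoment]
  ring

theorem momentW_of_ne {κ : ℝ} {p : ℕ × ℕ} (hp : p ≠ 0) : momentW κ p = posMoment κ p := by
  simp [momentW, hp]

theorem posMoment_pos {κ : ℝ} (hκ : 0 < κ) (p : ℕ × ℕ) : 0 < posMoment κ p := by
  unfold posMoment
  split_ifs <;> positivity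

theorem momentW_pos {κ : ℝ} (hκ : 0 < κ) (p : ℕ × ℕ) : 0 < momentW κ p := by
  by_cases hp : p = 0
  · rw [hp, momentW_zero]
    exact one_pos
  · rw [momentW_of_ne hp]
    exact posMoment_pos hκ p

theorem momentW_zero_succ (κ : ℝ) (m : ℕ) : momentW κ (0, m + 1) = κ ^ 2 := by
  simp [momentW, posMoment]
  ring

theorem momentW_succ_zero (κ : ℝ) (n : ℕ) :
    momentW κ (n + 1, 0) = κ ^ 2 / 2 * (1 + 1 / ((n : ℝ) + 2)) := by
  simp [momentW, posMoment]
  left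
  ring

theorem momentW_succ_succ (κ : ℝ) (n m : ℕ) : momentW κ (n + 1, m + 1) = κ ^ 2 / 2 := by
  simp [momentW, posMoment]

theorem momentW_zero' (κ : ℝ) : momentW κ (0, 0) = 1 := momentW_zero κ

theorem mul_sqrt_eq_sqrt_of_sq_mul {a b c : ℝ} (ha : 0 ≤ a) (h : a ^ 2 * b = c) :
    a * √b = √c := by
  rw [← h, Real.sqrt_mul (sq_nonneg a), Real.sqrt_sq ha]

/-- With its vertical analogue this identifies `momentW` as the squared products of weights along
lattice paths from the origin. -/
theorem alphaW_mul_sqrt {κ : ℝ} (hκ : 0 < κ) (p : ℕ × ℕ) :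
    alphaW κ p * √(momentW κ p) = √(momentW κ (p.1 + 1, p.2)) := by
  obtain ⟨n, m⟩ := p
  refine mul_sqrt_eq_sqrt_of_sq_mul ?_ ?_
  · simp only [alphaW, diagramAlpha, xWeight]
    split_ifs <;> positivity
  · rcases m with _ | m
    · rcases n with _ | n
      · simp only [alphaW, diagramAlpha, xWeight, momentW_zero', momentW_succ_zero, if_true,
          mul_pow]
        rw [Real.sq_sqrt (by norm_num)]
        norm_num
        ring
      · simp only [alphaW, diagramAlpha, xWeight, momentW_succ_zero, if_true, div_pow,
          Nat.succ_ne_zero, if_false]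
        rw [Real.sq_sqrt (by positivity)]
        push_cast
        field_simp
        ring
    · rcases n with _ | n
      · simp [alphaW, diagramAlpha, momentW_zero_succ, momentW_succ_succ]
        ring
      · simp [alphaW, diagramAlpha, momentW_succ_succ]

theorem betaW_mul_sqrt {κ : ℝ} (hκ : 0 < κ) (p : ℕ × ℕ) :
    betaW κ p * √(momentW κ p) = √(momentW κ (p.1, p.2 + 1)) := by
  obtain ⟨n, m⟩ := p
  rcases n with _ | n
  · refine mul_sqrt_eq_sqrt_of_sq_mul ?_ ?_
    · simp only [betaW, diagramBeta, if_true]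
      split_ifs <;> positivity
    · rcases m with _ | m <;> simp [betaW, diagramBeta, momentW_zero', momentW_zero_succ]
  · refine mul_sqrt_eq_sqrt_of_sq_mul ?_ ?_
    · simp only [betaW, diagramBeta, Nat.succ_ne_zero, if_false, prod_xWeight]
      split_ifs <;> positivity
    · rcases m with _ | m
      · simp only [betaW, diagramBeta, Nat.succ_ne_zero, if_false, prod_xWeight, if_true,
          momentW_succ_zero, momentW_succ_succ, div_pow, mul_pow, one_pow]
        rw [Real.sq_sqrt (by positivity), Real.sq_sqrt (by positivity)]
        field_simp
        ring
      · simp [betaW, diagramBeta, momentW_succ_succ]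

end Moments

/-! ### Row and column measures, and membership in `ClassH0`. -/

section ShiftSubnormal

open MeasureTheory unitInterval

/-- The first coordinate on the unit square. -/
noncomputable def coordS : C(I × I, ℝ) := ⟨fun p => p.1, by fun_prop⟩

/-- The second coordinate on the unit square. -/
noncomputable def coordT : C(I × I, ℝ) := ⟨fun p => p.2, by fun_prop⟩

/-- The density `√(2s)`. -/
noncomputable def sqrtDensity : C(I × I, ℝ) := ⟨fun p => √(2 * p.1), by fun_prop⟩

theorem integral_unitInterval_pow (n : ℕ) : ∫ x : I, (x : ℝ) ^ n = 1 / ((n : ℝ) + 1) := by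
  rw [unitInterval.measurePreserving_coe.integral_comp unitInterval.measurableEmbedding_coe
    (fun x : ℝ => x ^ n), integral_Icc_eq_integral_Ioc,
    ← intervalIntegral.integral_of_le zero_le_one, integral_pow]
  simp

/-- The coordinate `s` is the square root of the variable `x` of the moment measure: with `x = s²`,
`dx = 2s ds`, which explains the density `√(2s)`, and `∫ s^(2n) 2s ds = 1/(n+1)`. -/
theorem squareIntegral_sq (n m : ℕ) (f : C(I × I, ℝ)) (c : ℝ)
    (hf : ∀ x : I, f (x, 0) = c * √(2 * x)) :
    squareIntegral (coordS ^ n * coordT ^ m * f * (coordS ^ n * coordT ^ m * f)) =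
      (if n = 0 then f (0, 1) ^ 2 else 0) + f (1, 1) ^ 2 +
        if m = 0 then c ^ 2 / ((n : ℝ) + 1) else 0 := by
  have h1 : ∀ x : I, (x : ℝ) ^ n * (0 : ℝ) ^ m * (c * √(2 * x)) *
      ((x : ℝ) ^ n * (0 : ℝ) ^ m * (c * √(2 * x))) =
        (2 * c ^ 2 * (0 : ℝ) ^ m) * (x : ℝ) ^ (2 * n + 1) := by
    intro x
    have hx := Real.mul_self_sqrt (show (0 : ℝ) ≤ 2 * x by have := x.2.1; positivity)
    have h0 : (0 : ℝ) ^ m * 0 ^ m = 0 ^ m := by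
      rcases m with _ | m <;> simp
    calc _ = (c ^ 2 * (0 ^ m * 0 ^ m)) * ((x : ℝ) ^ n * (x : ℝ) ^ n) *
          (√(2 * x) * √(2 * x)) := by ring
      _ = _ := by rw [hx, h0]; ring
  simp only [squareIntegral, ContinuousMap.mul_apply, ContinuousMap.pow_apply, coordS, coordT,
    ContinuousMap.coe_mk, hf, Set.Icc.coe_zero, Set.Icc.coe_one, h1]
  rw [integral_const_mul, integral_unitInterval_pow]
  have h2 : 2 * ((n : ℝ) + 1) ≠ 0 := by positivity
  congr 1
  · congr 1
    · split_ifs with h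
      · subst h; simp; ring
      · simp [h]
    · simp; ring
  · split_ifs with h
    · subst h
      push_cast
      field_simp
      ring
    · simp [h]

/-- Row `0` has the representing measure `(1-κ²)δ₀ + κ²/2 δ₁ + κ²/2 dx`, and every higher row has
`κ²/2 (δ₀ + δ₁)`. These are positive because `κ < 1`. -/
theorem isSubnormalOperator_shiftW1 {κ : ℝ} (h0 : 0 < κ) (h1 : κ < 1) :
    IsSubnormalOperator (shiftW1 κ) := by
  -- The values at `(0,1)`, `(1,1)` and on `t = 0` are the square roots of the two masses and of the
  -- density of the row measure.
  set f : ℕ → C(I × I, ℝ) := fun m =>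
    if m = 0 then coordT * (√(1 - κ ^ 2) • (1 - coordS) + (κ / √2) • coordS) +
      (1 - coordT) * (κ / √2) • sqrtDensity else (κ / √2) • coordT with hf
  unfold shiftW1 shiftT1
  refine isSubnormalOperator_injectionShift (g := momentW κ) (χ := coordS) (e := (1, 0))
    (ψ := fun p => coordS ^ p.1 * coordT ^ 0 * f p.2) (fun p q h => by simpa [Prod.ext_iff] using h)
    (alphaW_bounded κ) (momentW_pos h0) ?_ ?_ ?_
    (alphaW_mul_sqrt h0)
  · rintro ⟨n, m⟩
    simp [add_comm]
  · rintro ⟨n, m⟩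
    have hk : 0 ≤ 1 - κ ^ 2 := by nlinarith
    rw [squareIntegral_sq n 0 (f m) (if m = 0 then κ / √2 else 0)]
    · rcases m with _ | m <;> rcases n with _ | n <;>
        simp [hf, coordS, coordT, sqrtDensity, momentW, posMoment, div_pow, Real.sq_sqrt, hk] <;>
        ring
    · intro x
      rcases m with _ | m <;> simp [hf, coordS, coordT, sqrtDensity]
  · rintro ⟨n, m⟩
    simp only [pow_succ]
    ring

/-- Column `n` has moments constant from height `1` on, hence the measure `(γ_(n,0) - γ_(n,1))δ₀ +
γ_(n,1)δ₁`. The coordinate `s` now plays the role of the vertical variable. -/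
theorem isSubnormalOperator_shiftW2 {κ : ℝ} (h0 : 0 < κ) (h1 : κ < 1) :
    IsSubnormalOperator (shiftW2 κ) := by
  set f : ℕ → C(I × I, ℝ) := fun n =>
    coordT * (√(momentW κ (n, 0) - momentW κ (n, 1)) • (1 - coordS) +
      √(momentW κ (n, 1)) • coordS) with hf
  unfold shiftW2 shiftT2
  refine isSubnormalOperator_injectionShift (g := momentW κ) (χ := coordS) (e := (0, 1))
    (ψ := fun p => coordS ^ p.2 * coordT ^ 0 * f p.1) (fun p q h => by simpa [Prod.ext_iff] using h)
    (betaW_bounded κ) (momentW_pos h0) ?_ ?_ ?_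
    (betaW_mul_sqrt h0)
  · rintro ⟨n, m⟩
    simp [add_comm]
  · rintro ⟨n, m⟩
    have hk : 0 ≤ momentW κ (n, 0) - momentW κ (n, 1) := by
      rcases n with _ | n
      · rw [momentW_zero', momentW_zero_succ]
        nlinarith
      · rw [momentW_succ_zero, momentW_succ_succ]
        have : 0 < κ ^ 2 / 2 * (1 / ((n : ℝ) + 2)) := by positivity
        linarith
    rw [squareIntegral_sq m 0 (f n) 0]
    · simp only [hf, coordS, coordT, ContinuousMap.mul_apply, ContinuousMap.add_apply,
        ContinuousMap.smul_apply, ContinuousMap.sub_apply, ContinuousMap.one_apply,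
        ContinuousMap.coe_mk, Set.Icc.coe_zero, Set.Icc.coe_one, smul_eq_mul]
      rcases m with _ | m
      · simp [Real.sq_sqrt hk, Real.sq_sqrt (momentW_pos h0 _).le]
      · have : momentW κ (n, m + 1) = momentW κ (n, 1) := by
          rcases n with _ | n <;> simp [momentW, posMoment]
        simp [Real.sq_sqrt (momentW_pos h0 _).le, this]
    · intro x
      simp [hf, coordS, coordT]
  · rintro ⟨n, m⟩
    simp only [pow_succ]
    ring

/-- The orthogonal vectors `√γ_p e_p`, which the shift with parameter `κ` permutes. -/
noncomputable def momentVec (κ : ℝ) (p : ℕ × ℕ) : Ell2 (ℕ × ℕ) :=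
  lp.single 2 p (√(momentW κ p) : ℂ)

theorem momentVec_eq_smul (κ : ℝ) (p : ℕ × ℕ) :
    momentVec κ p = (√(momentW κ p) : ℂ) • lp.single 2 p (1 : ℂ) :=
  ell2_single_smul _ _

theorem clm_ext_momentVec {κ : ℝ} (h0 : 0 < κ) {F : Type*} [AddCommGroup F] [Module ℂ F]
    [TopologicalSpace F] [T2Space F] {f g : Ell2 (ℕ × ℕ) →L[ℂ] F}
    (h : ∀ p, f (momentVec κ p) = g (momentVec κ p)) : f = g := by
  refine ell2_clm_ext fun p => ?_
  have hs : (√(momentW κ p) : ℂ) ≠ 0 :=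
    Complex.ofReal_ne_zero.2 (Real.sqrt_pos.2 (momentW_pos h0 p)).ne'
  have := h p
  rw [momentVec_eq_smul, map_smul, map_smul] at this
  have h2 := congrArg (fun x => (√(momentW κ p) : ℂ)⁻¹ • x) this
  simpa only [smul_smul, inv_mul_cancel₀ hs, one_smul] using h2

theorem shiftW1_momentVec {κ : ℝ} (h0 : 0 < κ) (p : ℕ × ℕ) :
    shiftW1 κ (momentVec κ p) = momentVec κ (p.1 + 1, p.2) := by
  have h : shiftW1 κ (lp.single 2 p (1 : ℂ)) = lp.single 2 (p.1 + 1, p.2) (alphaW κ p : ℂ) :=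
    injectionShift_single _ (fun p q h => by simpa [Prod.ext_iff] using h) _ (alphaW_bounded κ) _
  rw [momentVec_eq_smul, map_smul, h, ← lp.single_smul, momentVec, ← alphaW_mul_sqrt h0,
    smul_eq_mul, mul_comm, Complex.ofReal_mul]

theorem shiftW2_momentVec {κ : ℝ} (h0 : 0 < κ) (p : ℕ × ℕ) :
    shiftW2 κ (momentVec κ p) = momentVec κ (p.1, p.2 + 1) := by
  have h : shiftW2 κ (lp.single 2 p (1 : ℂ)) = lp.single 2 (p.1, p.2 + 1) (betaW κ p : ℂ) :=
    injectionShift_single _ (fun p q h => by simpa [Prod.ext_iff] using h) _ (betaW_bounded κ) _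
  rw [momentVec_eq_smul, map_smul, h, ← lp.single_smul, momentVec, ← betaW_mul_sqrt h0,
    smul_eq_mul, mul_comm, Complex.ofReal_mul]

theorem commute_shiftW {κ : ℝ} (h0 : 0 < κ) : Commute (shiftW1 κ) (shiftW2 κ) :=
  clm_ext_momentVec h0 fun p => by
    simp only [mul_apply_eq_comp, shiftW1_momentVec h0, shiftW2_momentVec h0]

theorem classH0_shiftW {κ : ℝ} (h0 : 0 < κ) (h1 : κ < 1) : ClassH0 (shiftW1 κ) (shiftW2 κ) :=
  ⟨commute_shiftW h0, isSubnormalOperator_shiftW1 h0 h1, isSubnormalOperator_shiftW2 h0 h1⟩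

end ShiftSubnormal

/-! ### Joint hyponormality without commutators. -/

section HyponormalForm

open ContinuousLinearMap

theorem complex_inner_self_nonneg {H : Type*} [NormedAddCommGroup H] [InnerProductSpace ℂ H]
    (x : H) : (0 : ℂ) ≤ inner ℂ x x := by
  rw [inner_self_eq_norm_sq_to_K]
  exact pow_nonneg (Complex.zero_le_real.2 (norm_nonneg x)) 2

/-- A Schur complement: adjoining the identity to the tuple changes the commutator form by the
square `‖v_o + Σ S_i* v_i‖²`, which a suitable `v_o` makes vanish. -/
theorem isJointlyHyponormal_iff_extended {H : Type*} [NormedAddCommGroup H]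
    [InnerProductSpace ℂ H] [CompleteSpace H] {ι : Type*} [DecidableEq ι] {E : Finset ι} {o : ι}
    (ho : o ∉ E) (S : ι → (H →L[ℂ] H)) (hS : S o = 1) :
    IsJointlyHyponormal (fun p : E => S p) ↔
      ∀ v : ι → H, 0 ≤ ∑ i ∈ insert o E, ∑ j ∈ insert o E, inner ℂ (S j (v i)) (S i (v j)) := by
  have key : ∀ v : ι → H,
      ∑ i ∈ insert o E, ∑ j ∈ insert o E, inner ℂ (S j (v i)) (S i (v j)) =
        (∑ i : E, ∑ j : E, inner ℂ (v i) ((adjoint (S j) * S i - S i * adjoint (S j)) (v j))) +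
          inner ℂ (v o + ∑ i ∈ E, adjoint (S i) (v i)) (v o + ∑ i ∈ E, adjoint (S i) (v i)) := by
    intro v
    have h1 : ∀ i j, inner ℂ (v i) ((adjoint (S j) * S i - S i * adjoint (S j)) (v j)) =
        inner ℂ (S j (v i)) (S i (v j)) - inner ℂ (adjoint (S i) (v i)) (adjoint (S j) (v j)) := by
      intro i j
      rw [sub_apply, inner_sub_right, mul_apply_eq_comp, mul_apply_eq_comp, adjoint_inner_right,
        adjoint_inner_left]
    simp only [h1]
    have h2 : ∀ f : ι → ι → ℂ, ∑ i : E, ∑ j : E, f i j = ∑ i ∈ E, ∑ j ∈ E, f i j := by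
      intro f
      rw [← Finset.sum_coe_sort E]
      exact Finset.sum_congr rfl fun i _ => Finset.sum_coe_sort E (f i)
    rw [h2 fun i j => inner ℂ (S j (v i)) (S i (v j)) -
      inner ℂ (adjoint (S i) (v i)) (adjoint (S j) (v j))]
    have h3 : ∀ i, inner ℂ (v o) (adjoint (S i) (v i)) = inner ℂ (S i (v o)) (v i) :=
      fun i => adjoint_inner_right _ _ _
    have h4 : ∀ i, inner ℂ (adjoint (S i) (v i)) (v o) = inner ℂ (v i) (S i (v o)) :=
      fun i => adjoint_inner_left _ _ _
    rw [inner_add_left, inner_add_right, inner_add_right, sum_inner, sum_inner]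
    simp only [Finset.sum_insert ho, hS, one_apply_eq_self, Finset.sum_sub_distrib, inner_sum,
      Finset.sum_add_distrib, h3, h4]
    ring
  constructor
  · intro h v
    rw [key]
    exact add_nonneg (h fun i => v i) (complex_inner_self_nonneg _)
  · intro h v
    set w := ∑ i : E, adjoint (S i) (v i) with hw
    have := h fun i => if hi : i ∈ E then v ⟨i, hi⟩ else -w
    rw [key] at this
    have h2 : ∑ i ∈ E, adjoint (S i) (if hi : i ∈ E then v ⟨i, hi⟩ else -w) = w := by
      rw [← Finset.sum_coe_sort E]
      simp [hw]
    rw [h2] at this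
    simpa [ho] using this

end HyponormalForm

/-! ### Reduction of `k`-hyponormality to one moment matrix. -/

section KHyponormal

open ContinuousLinearMap unitInterval

/-- Coordinatewise scaling of exponents. -/
def scaleExp (h l : ℕ) (p : ℕ × ℕ) : ℕ × ℕ := (h * p.1, l * p.2)

theorem scaleExp_zero (h l : ℕ) : scaleExp h l 0 = 0 := rfl

theorem scaleExp_eq_zero {h l : ℕ} (hh : 1 ≤ h) (hl : 1 ≤ l) {p : ℕ × ℕ} :
    scaleExp h l p = 0 ↔ p = 0 := by
  have h1 : h ≠ 0 := by omega
  have h2 : l ≠ 0 := by omega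
  simp [scaleExp, Prod.ext_iff, h1, h2]

/-- The monomial `(T₂ˡ)^q (T₁ʰ)^p` in the powers of the shift. -/
noncomputable def shiftMonomial (κ : ℝ) (h l : ℕ) (p : ℕ × ℕ) :
    Ell2 (ℕ × ℕ) →L[ℂ] Ell2 (ℕ × ℕ) :=
  (shiftW2 κ ^ l) ^ p.2 * (shiftW1 κ ^ h) ^ p.1

theorem shiftMonomial_zero (κ : ℝ) (h l : ℕ) : shiftMonomial κ h l 0 = 1 := by
  simp [shiftMonomial]

theorem shiftMonomial_momentVec {κ : ℝ} (h0 : 0 < κ) (h l : ℕ) (p q : ℕ × ℕ) :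
    shiftMonomial κ h l p (momentVec κ q) = momentVec κ (scaleExp h l p + q) := by
  have h1 : ∀ (n : ℕ) (q : ℕ × ℕ), (shiftW1 κ ^ n) (momentVec κ q) = momentVec κ ((n, 0) + q) := by
    intro n
    induction n with
    | zero => simp
    | succ n ih =>
      intro q
      rw [pow_succ, mul_apply_eq_comp, shiftW1_momentVec h0, ih]
      congr 1
      ext <;> simp
      ring
  have h2 : ∀ (n : ℕ) (q : ℕ × ℕ), (shiftW2 κ ^ n) (momentVec κ q) = momentVec κ ((0, n) + q) := by
    intro n
    induction n with
    | zero => simp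
    | succ n ih =>
      intro q
      rw [pow_succ, mul_apply_eq_comp, shiftW2_momentVec h0, ih]
      congr 1
      ext <;> simp
      ring
  rw [shiftMonomial, ← pow_mul, ← pow_mul, mul_apply_eq_comp, h1, h2]
  congr 1
  ext <;> simp [scaleExp]

theorem inner_momentVec {κ : ℝ} (h0 : 0 < κ) (p q : ℕ × ℕ) :
    inner ℂ (momentVec κ p) (momentVec κ q) = if p = q then (momentW κ p : ℂ) else 0 := by
  rw [momentVec, lp.inner_single_left, momentVec, lp.single_apply]
  split_ifs with h
  · subst h
    simp only [Pi.single_eq_same, RCLike.inner_apply, Complex.conj_ofReal]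
    norm_cast
    rw [Real.mul_self_sqrt (momentW_pos h0 p).le]
  · simp [h]

/-- The function `sⁿ tᵐ κ/√2 (t + (1 - t) √(2s))`. -/
noncomputable def momentFun (κ : ℝ) (p : ℕ × ℕ) : C(I × I, ℝ) :=
  coordS ^ p.1 * coordT ^ p.2 * ((κ / √2) • (coordT + (1 - coordT) * sqrtDensity))

theorem squareIntegral_momentFun (κ : ℝ) (p : ℕ × ℕ) :
    squareIntegral (momentFun κ p * momentFun κ p) = posMoment κ p := by
  rw [momentFun, squareIntegral_sq _ _ _ (κ / √2)]
  · simp only [coordT, sqrtDensity, posMoment, ContinuousMap.smul_apply,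
      ContinuousMap.add_apply, ContinuousMap.mul_apply, ContinuousMap.sub_apply,
      ContinuousMap.one_apply, ContinuousMap.coe_mk, Set.Icc.coe_one, smul_eq_mul, sub_self,
      zero_mul, add_zero, mul_one, div_pow, Real.sq_sqrt zero_le_two]
    split_ifs <;> ring
  · intro x
    simp [coordT, sqrtDensity]

theorem coord_mul_momentFun (κ : ℝ) (p q : ℕ × ℕ) :
    (coordS ^ p.1 * coordT ^ p.2) * momentFun κ q = momentFun κ (p + q) := by
  simp only [momentFun, Prod.fst_add, Prod.snd_add, pow_add]
  ring

theorem momentFun_mul_momentFun (κ : ℝ) {p q p' q' : ℕ × ℕ} (h : p + q = p' + q') :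
    momentFun κ p * momentFun κ q = momentFun κ p' * momentFun κ q' := by
  obtain ⟨h1, h2⟩ := Prod.ext_iff.1 h
  simp only [Prod.fst_add, Prod.snd_add] at h1 h2
  have h3 : ∀ p q : ℕ × ℕ, momentFun κ p * momentFun κ q = coordS ^ (p.1 + q.1) *
      coordT ^ (p.2 + q.2) * (((κ / √2) • (coordT + (1 - coordT) * sqrtDensity)) *
        ((κ / √2) • (coordT + (1 - coordT) * sqrtDensity))) := by
    intro p q
    simp only [momentFun, pow_add]
    ring
  rw [h3, h3, h1, h2]

/-- The positive part of the moments differs from `momentW` only at the origin, so the natural map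
to the model is an isometry except that it scales `e₀` by `√(3κ²/2)`. -/
theorem exists_modelMap {κ : ℝ} (h0 : 0 < κ) :
    ∃ V : Ell2 (ℕ × ℕ) →L[ℂ] ModelSpace,
      (∀ p, V (momentVec κ p) = modelVec (momentFun κ p) p) ∧
      ∀ f g, inner ℂ (V f) (V g) =
        inner ℂ f g + (3 / 2 * κ ^ 2 - 1 : ℝ) * (starRingEnd ℂ (f 0) * g 0) := by
  have hg := posMoment_pos h0
  have hs : ∀ p, √(posMoment κ p) ≠ 0 := fun p => (Real.sqrt_pos.2 (hg p)).ne'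
  set u : ℕ × ℕ → ModelSpace := fun p => modelVec ((√(posMoment κ p))⁻¹ • momentFun κ p) p with hu
  have hon : Orthonormal ℂ u := by
    rw [orthonormal_iff_ite]
    intro p q
    simp only [hu, modelVec_smul, inner_smul_left, inner_smul_right, inner_modelVec]
    split_ifs with h
    · subst h
      rw [squareIntegral_momentFun, Complex.conj_ofReal]
      norm_cast
      have := Real.mul_self_sqrt (hg p).le
      rw [← this]
      field_simp [hs p]
      simp [Real.sqrt_sq]
    · simp
  set V' := hon.orthogonalFamily.linearIsometry with hV'
  have hV1 : ∀ p, V' (lp.single 2 p (1 : ℂ)) = u p := by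
    intro p
    rw [hV', OrthogonalFamily.linearIsometry_apply_single, LinearIsometry.toSpanSingleton_apply,
      one_smul]
  set r := √(posMoment κ 0) with hr
  have hr2 : r * r = 3 / 2 * κ ^ 2 := by
    rw [hr, Real.mul_self_sqrt (hg 0).le]
    norm_num [posMoment]
    ring
  have hV2 : ∀ f, inner ℂ (V' f) (u 0) = starRingEnd ℂ (f 0) := by
    intro f
    rw [← hV1, V'.inner_map_map, lp.inner_single_right]
    simp
  have hV3 : ∀ f, inner ℂ (u 0) (V' f) = f 0 := by
    intro f
    rw [← inner_conj_symm, hV2, Complex.conj_conj]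
  have hE : ∀ f : Ell2 (ℕ × ℕ), inner ℂ (lp.single 2 (0 : ℕ × ℕ) (1 : ℂ)) f = f 0 := by
    intro f
    rw [lp.inner_single_left]
    simp
  have huu : inner ℂ (u 0) (u 0) = (1 : ℂ) := by simpa using (orthonormal_iff_ite.1 hon) 0 0
  -- The rank-one term multiplies the image of `e₀` by `r` and leaves the other basis vectors alone.
  refine ⟨V'.toContinuousLinearMap +
    (innerSL ℂ (lp.single 2 (0 : ℕ × ℕ) (1 : ℂ))).smulRight (((r - 1 : ℝ) : ℂ) • u 0), ?_, ?_⟩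
  · intro p
    have hUp : modelVec (momentFun κ p) p = (√(posMoment κ p) : ℂ) • u p := by
      rw [hu]
      simp only [modelVec_smul, smul_smul]
      rw [← Complex.ofReal_mul, mul_inv_cancel₀ (hs p), Complex.ofReal_one, one_smul]
    rw [hUp, momentVec_eq_smul, map_smul]
    simp only [add_apply, LinearIsometry.coe_toContinuousLinearMap, smulRight_apply,
      innerSL_apply_apply, hE, hV1]
    by_cases hp : p = 0
    · subst hp
      rw [momentW_zero, ← hr]
      simp [sub_smul]
    · rw [momentW_of_ne hp]
      simp [lp.single_apply, Ne.symm hp]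
  · intro f g
    simp only [add_apply, LinearIsometry.coe_toContinuousLinearMap, smulRight_apply,
      innerSL_apply_apply, hE, inner_add_left, inner_add_right, inner_smul_left, inner_smul_right,
      V'.inner_map_map, hV2, hV3, huu, Complex.conj_ofReal]
    rw [← hr2]
    push_cast
    ring

theorem shiftMonomial_apply_zero {κ : ℝ} (h0 : 0 < κ) {h l : ℕ} (hh : 1 ≤ h) (hl : 1 ≤ l)
    (p : ℕ × ℕ) (f : Ell2 (ℕ × ℕ)) :
    shiftMonomial κ h l p f 0 = if p = 0 then f 0 else 0 := by
  split_ifs with hp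
  · rw [hp, shiftMonomial_zero, one_apply_eq_self]
  · have hE : ∀ f : Ell2 (ℕ × ℕ), innerSL ℂ (lp.single 2 (0 : ℕ × ℕ) (1 : ℂ)) f = f 0 := by
      intro f
      rw [innerSL_apply_apply, lp.inner_single_left]
      simp
    have key : (innerSL ℂ (lp.single 2 (0 : ℕ × ℕ) (1 : ℂ))).comp (shiftMonomial κ h l p) = 0 := by
      refine clm_ext_momentVec h0 fun q => ?_
      have hne : (0 : ℕ × ℕ) ≠ scaleExp h l p + q := by
        intro hc
        have := (add_eq_zero.1 hc.symm).1
        exact hp ((scaleExp_eq_zero hh hl).1 this)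
      rw [comp_apply, shiftMonomial_momentVec h0, hE, momentVec, lp.single_apply_ne _ _ _ hne]
      simp
    rw [← hE]
    exact DFunLike.congr_fun key f

/-- The quadratic form of the moment matrix of the powers of the shift. -/
noncomputable def momentForm (κ : ℝ) (h l : ℕ) (E : Finset (ℕ × ℕ)) (d : ℕ × ℕ → ℂ) : ℂ :=
  ∑ i ∈ E, ∑ j ∈ E,
    starRingEnd ℂ (d i) * d j * (momentW κ (scaleExp h l i + scaleExp h l j) : ℂ)

theorem momentForm_eq {κ : ℝ} {h l : ℕ} (hh : 1 ≤ h) (hl : 1 ≤ l) {E : Finset (ℕ × ℕ)}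
    (hE : 0 ∈ E) (d : ℕ × ℕ → ℂ) :
    momentForm κ h l E d =
      (∑ i ∈ E, ∑ j ∈ E,
        starRingEnd ℂ (d i) * d j * (posMoment κ (scaleExp h l i + scaleExp h l j) : ℂ)) +
      ((1 - 3 / 2 * κ ^ 2 : ℝ) : ℂ) * (starRingEnd ℂ (d 0) * d 0) := by
  have h1 : ∀ i j, starRingEnd ℂ (d i) * d j * (momentW κ (scaleExp h l i + scaleExp h l j) : ℂ) =
      starRingEnd ℂ (d i) * d j * (posMoment κ (scaleExp h l i + scaleExp h l j) : ℂ) +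
        if i = 0 then
          if j = 0 then ((1 - 3 / 2 * κ ^ 2 : ℝ) : ℂ) * (starRingEnd ℂ (d 0) * d 0) else 0
        else 0 := by
    intro i j
    simp only [momentW, add_eq_zero, scaleExp_eq_zero hh hl]
    by_cases hi : i = 0 <;> by_cases hj : j = 0 <;> simp [hi, hj]
    ring
  simp only [momentForm, h1, Finset.sum_add_distrib]
  simp [hE]

/-- In the model the left-over form is `‖Y‖²` plus the defect at the origin, with `Y = Σ N_i* V
v_i`. Projecting `Y` onto degree-`0` vectors `x_i` can only decrease it, and the projection sees
nothing of `v_i` except its coordinate at the scaled exponent of `i`. So the moment matrix at the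
origin controls all vectors, and no other base point needs a test. -/
theorem momentForm_le {κ : ℝ} (h0 : 0 < κ) {h l : ℕ} (hh : 1 ≤ h) (hl : 1 ≤ l)
    {E : Finset (ℕ × ℕ)} (hE : 0 ∈ E) (v : ℕ × ℕ → Ell2 (ℕ × ℕ)) :
    momentForm κ h l E (fun i => ((√(momentW κ (scaleExp h l i)))⁻¹ : ℝ) * v i (scaleExp h l i)) ≤
      ∑ i ∈ E, ∑ j ∈ E,
        inner ℂ (shiftMonomial κ h l j (v i)) (shiftMonomial κ h l i (v j)) := by
  obtain ⟨V, hV, hVV⟩ := exists_modelMap h0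
  set d : ℕ × ℕ → ℂ :=
    fun i => ((√(momentW κ (scaleExp h l i)))⁻¹ : ℝ) * v i (scaleExp h l i) with hd
  have hd0 : d 0 = v 0 0 := by simp [hd, scaleExp_zero, momentW_zero]
  set N : ℕ × ℕ → (ModelSpace →L[ℂ] ModelSpace) := fun i =>
    modelOp (coordS ^ (scaleExp h l i).1 * coordT ^ (scaleExp h l i).2) (scaleExp h l i) with hN
  have hNV : ∀ i f, V (shiftMonomial κ h l i f) = N i (V f) := by
    intro i
    have : V.comp (shiftMonomial κ h l i) = (N i).comp V := by
      refine clm_ext_momentVec h0 fun q => ?_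
      rw [comp_apply, comp_apply, shiftMonomial_momentVec h0, hV, hV, hN, modelOp_modelVec,
        coord_mul_momentFun]
    exact fun f => DFunLike.congr_fun this f
  have hVU : ∀ (ψ : C(I × I, ℝ)) (p : ℕ × ℕ) (f : Ell2 (ℕ × ℕ)),
      inner ℂ (modelVec ψ p) (V f) =
        (((√(momentW κ p))⁻¹ : ℝ) * f p) * (squareIntegral (ψ * momentFun κ p) : ℂ) := by
    intro ψ p
    have hE' : ∀ f : Ell2 (ℕ × ℕ), innerSL ℂ (lp.single 2 p (1 : ℂ)) f = f p := by
      intro f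
      rw [innerSL_apply_apply, lp.inner_single_left]
      simp
    have : (innerSL ℂ (modelVec ψ p)).comp V =
        ((((√(momentW κ p))⁻¹ : ℝ) : ℂ) * (squareIntegral (ψ * momentFun κ p) : ℂ)) •
          innerSL ℂ (lp.single 2 p (1 : ℂ)) := by
      refine clm_ext_momentVec h0 fun q => ?_
      rw [comp_apply, hV, innerSL_apply_apply, inner_modelVec, smul_apply, hE']
      by_cases hpq : p = q
      · subst hpq
        have hs : (√(momentW κ p) : ℂ) ≠ 0 :=
          Complex.ofReal_ne_zero.2 (Real.sqrt_pos.2 (momentW_pos h0 p)).ne'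
        rw [if_pos rfl, momentVec, lp.single_apply_self, smul_eq_mul, Complex.ofReal_inv]
        field_simp
      · rw [if_neg hpq, momentVec, lp.single_apply_ne _ _ _ hpq, smul_zero]
    intro f
    have h2 := DFunLike.congr_fun this f
    rw [comp_apply, innerSL_apply_apply, smul_apply, hE', smul_eq_mul] at h2
    rw [h2]
    ring
  set Y := ∑ i ∈ E, adjoint (N i) (V (v i)) with hY
  have hF : ∑ i ∈ E, ∑ j ∈ E,
      inner ℂ (shiftMonomial κ h l j (v i)) (shiftMonomial κ h l i (v j)) =
        inner ℂ Y Y + ((1 - 3 / 2 * κ ^ 2 : ℝ) : ℂ) * (starRingEnd ℂ (d 0) * d 0) := by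
    have h1 : ∀ i j, inner ℂ (shiftMonomial κ h l j (v i)) (shiftMonomial κ h l i (v j)) =
        inner ℂ (adjoint (N i) (V (v i))) (adjoint (N j) (V (v j))) +
          if i = 0 then
            if j = 0 then ((1 - 3 / 2 * κ ^ 2 : ℝ) : ℂ) * (starRingEnd ℂ (d 0) * d 0) else 0
          else 0 := by
      intro i j
      have h2 := hVV (shiftMonomial κ h l j (v i)) (shiftMonomial κ h l i (v j))
      rw [hNV, hNV, shiftMonomial_apply_zero h0 hh hl, shiftMonomial_apply_zero h0 hh hl, hN,
        inner_modelOp_modelOp] at h2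
      rw [hN, h2, hd0]
      by_cases hi : i = 0 <;> by_cases hj : j = 0 <;> simp [hi, hj]
      ring
    rw [hY, sum_inner]
    simp only [h1, Finset.sum_add_distrib, inner_sum]
    simp [hE]
  -- The exponent is doubled because `N_i* N_i` multiplies by the square of the modulus; the Gram
  -- matrix of the `x i` is then the positive part of the moment matrix.
  set x : ℕ × ℕ → ModelSpace := fun i =>
    modelVec (momentFun κ (scaleExp h l i + scaleExp h l i)) 0 with hx
  set y := ∑ i ∈ E, d i • x i with hy
  have hE2 : ∀ i j, squareIntegral (momentFun κ (scaleExp h l i + scaleExp h l i) *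
      momentFun κ (scaleExp h l j + scaleExp h l j)) =
        posMoment κ (scaleExp h l i + scaleExp h l j) := by
    intro i j
    rw [← squareIntegral_momentFun]
    congr 1
    exact momentFun_mul_momentFun κ (by abel)
  -- Moving `N_i` to the left turns `x k` into a vector of degree `scaleExp h l i`, which picks out
  -- one coordinate of `v i`.
  have hxY : ∀ k, inner ℂ (x k) Y = inner ℂ (x k) y := by
    intro k
    rw [hY, hy, inner_sum, inner_sum]
    refine Finset.sum_congr rfl fun i _ => ?_
    rw [adjoint_inner_right, hN, hx, inner_smul_right, inner_modelVec, if_pos rfl, hE2,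
      modelOp_modelVec, add_zero, hVU, coord_mul_momentFun, ← squareIntegral_momentFun]
    congr 3
    exact momentFun_mul_momentFun κ (by abel)
  have hyY : inner ℂ y Y = inner ℂ y y := by
    conv_lhs => rw [hy, sum_inner]
    conv_rhs => rw [hy, sum_inner, ← hy]
    refine Finset.sum_congr rfl fun i _ => ?_
    rw [inner_smul_left, inner_smul_left, hxY]
  have hle : inner ℂ y y ≤ inner ℂ Y Y := by
    have h1 : inner ℂ Y Y = inner ℂ y y + inner ℂ (Y - y) (Y - y) := by
      have h2 : inner ℂ Y y = inner ℂ y y := by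
        rw [← inner_conj_symm, hyY, inner_conj_symm]
      rw [inner_sub_left, inner_sub_right, inner_sub_right, hyY, h2]
      ring
    rw [h1]
    exact le_add_of_nonneg_right (complex_inner_self_nonneg _)
  have hyy : inner ℂ y y = ∑ i ∈ E, ∑ j ∈ E,
      starRingEnd ℂ (d i) * d j * (posMoment κ (scaleExp h l i + scaleExp h l j) : ℂ) := by
    rw [hy, sum_inner]
    refine Finset.sum_congr rfl fun i _ => ?_
    rw [inner_sum]
    refine Finset.sum_congr rfl fun j _ => ?_
    rw [inner_smul_left, inner_smul_right, hx, inner_modelVec, if_pos rfl, hE2]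
    ring
  rw [hF, momentForm_eq hh hl hE, ← hyy]
  gcongr

/-- Necessity tests the extended form on multiples of `momentVec`, where it is exactly the moment
form; sufficiency is `momentForm_le`. -/
theorem isKHyponormal_iff_momentForm {κ : ℝ} (h0 : 0 < κ) (k : ℕ) {h l : ℕ} (hh : 1 ≤ h)
    (hl : 1 ≤ l) :
    IsKHyponormal k (shiftW1 κ ^ h) (shiftW2 κ ^ l) ↔
      ∀ d, 0 ≤ momentForm κ h l (insert 0 (exponentsUpTo k)) d := by
  have ho : (0 : ℕ × ℕ) ∉ exponentsUpTo k := by simp [exponentsUpTo]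
  refine (isJointlyHyponormal_iff_extended ho (shiftMonomial κ h l)
    (shiftMonomial_zero κ h l)).trans ⟨fun H d => ?_, fun H v => ?_⟩
  · refine (H fun i => d i • momentVec κ (scaleExp h l i)).trans_eq ?_
    refine Finset.sum_congr rfl fun i _ => Finset.sum_congr rfl fun j _ => ?_
    rw [map_smul, map_smul, shiftMonomial_momentVec h0, shiftMonomial_momentVec h0,
      inner_smul_left, inner_smul_right, inner_momentVec h0,
      add_comm (scaleExp h l j), if_pos rfl, mul_assoc]
  · exact (H _).trans (momentForm_le h0 hh hl (Finset.mem_insert_self _ _) v)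

end KHyponormal

/-! ### The Müntz distance by successive Schur complements. -/

section HilbertForm

open ComplexConjugate

/-- The quadratic form of the Gram matrix `1 / (h (i + j) + 1)` of the functions `t ^ (h i)` in
`L²(0, 1)`. -/
noncomputable def hilbertForm (h : ℝ) (n : ℕ) (d : ℕ → ℂ) : ℂ :=
  ∑ i ∈ Finset.range n, ∑ j ∈ Finset.range n,
    conj (d i) * d j * ((1 / (h * ((i : ℝ) + j) + 1) : ℝ) : ℂ)

theorem hilbertForm_one (h : ℝ) (d : ℕ → ℂ) : hilbertForm h 1 d = conj (d 0) * d 0 := by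
  simp [hilbertForm]

/-- The Blaschke-type factor attached to the exponent `h k`. -/
noncomputable def blaschkeFactor (h : ℝ) (k i : ℕ) : ℝ :=
  h * ((i : ℝ) - k) / (h * ((i : ℝ) + k) + 1)

/-- One pivot step in a Cauchy-type matrix: the Schur complement with respect to index `k` is again
the same matrix, conjugated by the diagonal of factors `blaschkeFactor h k i`. -/
theorem hilbertForm_succ {h : ℝ} (hh : 0 < h) (k : ℕ) (d : ℕ → ℂ) :
    hilbertForm h (k + 1) d = hilbertForm h k (fun i => (blaschkeFactor h k i : ℂ) * d i) +
      ((2 * h * k + 1 : ℝ) : ℂ) *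
        (conj (∑ i ∈ Finset.range (k + 1), d i * ((1 / (h * ((i : ℝ) + k) + 1) : ℝ) : ℂ)) *
          ∑ i ∈ Finset.range (k + 1), d i * ((1 / (h * ((i : ℝ) + k) + 1) : ℝ) : ℂ)) := by
  have h1 : hilbertForm h k (fun i => (blaschkeFactor h k i : ℂ) * d i) =
      hilbertForm h (k + 1) (fun i => (blaschkeFactor h k i : ℂ) * d i) := by
    -- The factor vanishes at the pivot, so the sum may run up to `k` inclusive.
    have hk : blaschkeFactor h k k = 0 := by simp [blaschkeFactor]
    simp [hilbertForm, Finset.sum_range_succ, hk]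
  rw [h1]
  simp only [hilbertForm, map_sum]
  rw [Finset.sum_mul_sum]
  simp only [Finset.mul_sum, ← Finset.sum_add_distrib]
  refine Finset.sum_congr rfl fun i _ => Finset.sum_congr rfl fun j _ => ?_
  have key : 1 / (h * ((i : ℝ) + j) + 1) =
      blaschkeFactor h k i * blaschkeFactor h k j * (1 / (h * ((i : ℝ) + j) + 1)) +
        (2 * h * k + 1) * (1 / (h * ((i : ℝ) + k) + 1) * (1 / (h * ((j : ℝ) + k) + 1))) := by
    unfold blaschkeFactor
    have h2 : h * ((i : ℝ) + j) + 1 ≠ 0 := by positivity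
    have h3 : h * ((i : ℝ) + k) + 1 ≠ 0 := by positivity
    have h4 : h * ((j : ℝ) + k) + 1 ≠ 0 := by positivity
    field_simp
    ring
  conv_lhs => rw [key]
  simp only [map_mul, Complex.conj_ofReal, Complex.ofReal_add, Complex.ofReal_mul]
  ring

/-- The squared distance in `L²(0, 1)` of `1` to the span of `t ^ (h j)`, `1 ≤ j ≤ k`. -/
noncomputable def muntzDistSq (h : ℝ) (k : ℕ) : ℝ :=
  ∏ j ∈ Finset.range k, (h * ((j : ℝ) + 1) / (h * ((j : ℝ) + 1) + 1)) ^ 2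

theorem muntzDistSq_succ (h : ℝ) (k : ℕ) :
    muntzDistSq h (k + 1) = muntzDistSq h k * blaschkeFactor h (k + 1) 0 ^ 2 := by
  rw [muntzDistSq, Finset.prod_range_succ, ← muntzDistSq, blaschkeFactor]
  push_cast
  congr 1
  rw [zero_add, zero_sub, mul_neg, neg_div, neg_sq]

theorem muntzDistSq_le_hilbertForm {h : ℝ} (hh : 0 < h) (k : ℕ) (d : ℕ → ℂ) :
    (muntzDistSq h k : ℂ) * (conj (d 0) * d 0) ≤ hilbertForm h (k + 1) d := by
  induction k generalizing d with
  | zero => simp [muntzDistSq, hilbertForm_one]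
  | succ k ih =>
    rw [hilbertForm_succ hh]
    refine le_add_of_le_of_nonneg (le_trans (le_of_eq ?_) (ih _)) ?_
    · rw [muntzDistSq_succ]
      simp only [map_mul, Complex.conj_ofReal, Complex.ofReal_mul, Complex.ofReal_pow]
      ring
    · exact mul_nonneg (Complex.zero_le_real.2 (by positivity)) (star_mul_self_nonneg _)

/-- The lower bound is attained: at each pivot step the new coordinate is chosen to annihilate the
discarded square. -/
theorem exists_hilbertForm_eq_muntzDistSq {h : ℝ} (hh : 0 < h) (k : ℕ) :
    ∃ d : ℕ → ℂ, d 0 = 1 ∧ hilbertForm h (k + 1) d = muntzDistSq h k := by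
  induction k with
  | zero => exact ⟨fun _ => 1, rfl, by simp [hilbertForm_one, muntzDistSq]⟩
  | succ k ih =>
    obtain ⟨e, he0, he⟩ := ih
    set b : ℕ → ℂ := fun i => (blaschkeFactor h (k + 1) i : ℂ) with hb
    have hb0 : ∀ i < k + 1, b i ≠ 0 := by
      intro i hi
      have h1 : (i : ℝ) - (k + 1 : ℕ) ≠ 0 := sub_ne_zero.2 (by exact_mod_cast hi.ne)
      refine Complex.ofReal_ne_zero.2 (div_ne_zero (mul_ne_zero hh.ne' h1) ?_)
      positivity
    -- Chosen so that `b i * d i = b 0 * e i`, a multiple of the previous minimiser, while `d 0 =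
    -- 1`.
    set a : ℕ → ℂ := fun i => e i * b 0 / b i with ha
    set c : ℂ := -((h * (((k + 1 : ℕ) : ℝ) + (k + 1 : ℕ)) + 1 : ℝ) : ℂ) *
      ∑ i ∈ Finset.range (k + 1), a i * ((1 / (h * ((i : ℝ) + (k + 1 : ℕ)) + 1) : ℝ) : ℂ) with hc
    set d : ℕ → ℂ := fun i => if i = k + 1 then c else a i with hd
    have hda : ∀ i ∈ Finset.range (k + 1), d i = a i := fun i hi => by
      rw [hd]
      exact if_neg (Finset.mem_range.1 hi).ne
    refine ⟨d, ?_, ?_⟩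
    · rw [hda 0 (by simp), ha]
      simp [he0, hb0 0 (by omega)]
    · have hL : ∑ i ∈ Finset.range (k + 1 + 1),
          d i * ((1 / (h * ((i : ℝ) + (k + 1 : ℕ)) + 1) : ℝ) : ℂ) = 0 := by
        have hx : ((h * (((k + 1 : ℕ) : ℝ) + (k + 1 : ℕ)) + 1 : ℝ) : ℂ) ≠ 0 :=
          Complex.ofReal_ne_zero.2 (by positivity)
        rw [Finset.sum_range_succ, Finset.sum_congr rfl fun i hi => by rw [hda i hi]]
        have : d (k + 1) = c := by simp [hd]
        rw [this, hc, one_div, Complex.ofReal_inv, mul_right_comm, neg_mul, mul_inv_cancel₀ hx]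
        ring
      have h2 : hilbertForm h (k + 1) (fun i => b i * d i) =
          b 0 * b 0 * hilbertForm h (k + 1) e := by
        have h3 : ∀ i ∈ Finset.range (k + 1), b i * d i = b 0 * e i := fun i hi => by
          rw [hda i hi, ha]
          have := hb0 i (Finset.mem_range.1 hi)
          field_simp
        simp only [hilbertForm, Finset.mul_sum]
        refine Finset.sum_congr rfl fun i hi => Finset.sum_congr rfl fun j hj => ?_
        rw [h3 i hi, h3 j hj, map_mul, hb, Complex.conj_ofReal]
        ring
      rw [hilbertForm_succ hh, hL, h2, he, muntzDistSq_succ]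
      simp only [hb, mul_zero, add_zero, Complex.ofReal_mul, Complex.ofReal_pow]
      ring

end HilbertForm

/-! ### Positivity of the moment form, for `k ≥ 2` and for `k = 1`. -/

section Criterion

open ComplexConjugate

theorem sum_row_exponents (k : ℕ) (f : ℕ × ℕ → ℂ) :
    (∑ i ∈ insert 0 (exponentsUpTo k), if i.2 = 0 then f i else 0) =
      ∑ n ∈ Finset.range (k + 1), f (n, 0) := by
  rw [← Finset.sum_filter]
  have : (insert 0 (exponentsUpTo k)).filter (fun i => i.2 = 0) =
      (Finset.range (k + 1)).image fun n => (n, 0) := by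
    ext ⟨n, m⟩
    simp [exponentsUpTo, Prod.ext_iff]
    omega
  rw [this, Finset.sum_image (by simp)]

/-- The three squares come from `δ_(1,1)`, `δ_(0,1)` and `dx × δ₀`. Scaling by `l` disappears
because the measure lives on `t ∈ {0, 1}`. -/
theorem momentForm_eq_hilbertForm {κ : ℝ} {h l : ℕ} (hh : 1 ≤ h) (hl : 1 ≤ l) (k : ℕ)
    (d : ℕ × ℕ → ℂ) :
    momentForm κ h l (insert 0 (exponentsUpTo k)) d =
      ((κ ^ 2 / 2 : ℝ) : ℂ) *
        (conj (∑ i ∈ insert 0 (exponentsUpTo k), d i) * (∑ i ∈ insert 0 (exponentsUpTo k), d i) +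
        conj (∑ i ∈ insert 0 (exponentsUpTo k), if i.1 = 0 then d i else 0) *
          (∑ i ∈ insert 0 (exponentsUpTo k), if i.1 = 0 then d i else 0) +
        hilbertForm h (k + 1) fun n => d (n, 0)) +
      ((1 - 3 / 2 * κ ^ 2 : ℝ) : ℂ) * (conj (d 0) * d 0) := by
  have hh' : h ≠ 0 := by omega
  have hl' : l ≠ 0 := by omega
  rw [momentForm_eq hh hl (Finset.mem_insert_self _ _)]
  congr 1
  have hH : hilbertForm h (k + 1) (fun n => d (n, 0)) =
      ∑ i ∈ insert 0 (exponentsUpTo k), ∑ j ∈ insert 0 (exponentsUpTo k),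
        if i.2 = 0 then if j.2 = 0 then
          conj (d i) * d j * ((1 / (h * ((i.1 : ℝ) + j.1) + 1) : ℝ) : ℂ) else 0 else 0 := by
    have h1 : ∀ i : ℕ × ℕ, (∑ j ∈ insert 0 (exponentsUpTo k), if i.2 = 0 then if j.2 = 0 then
          conj (d i) * d j * ((1 / (h * ((i.1 : ℝ) + j.1) + 1) : ℝ) : ℂ) else 0 else 0) =
        if i.2 = 0 then ∑ n ∈ Finset.range (k + 1),
          conj (d i) * d (n, 0) * ((1 / (h * ((i.1 : ℝ) + n) + 1) : ℝ) : ℂ) else 0 := by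
      intro i
      split_ifs
      · exact sum_row_exponents k fun j =>
          conj (d i) * d j * ((1 / (h * ((i.1 : ℝ) + j.1) + 1) : ℝ) : ℂ)
      · simp
    simp only [h1]
    rw [sum_row_exponents k fun i => ∑ n ∈ Finset.range (k + 1),
          conj (d i) * d (n, 0) * ((1 / (h * ((i.1 : ℝ) + n) + 1) : ℝ) : ℂ)]
    rfl
  rw [hH]
  simp only [map_sum]
  rw [Finset.sum_mul_sum, Finset.sum_mul_sum]
  simp only [← Finset.sum_add_distrib, Finset.mul_sum]
  refine Finset.sum_congr rfl fun i _ => Finset.sum_congr rfl fun j _ => ?_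
  obtain ⟨i1, i2⟩ := i
  obtain ⟨j1, j2⟩ := j
  simp only [posMoment, scaleExp, Prod.mk_add_mk, add_eq_zero, mul_eq_zero, hh', hl', false_or]
  by_cases a1 : i1 = 0 <;> by_cases a2 : j1 = 0 <;> by_cases a3 : i2 = 0 <;>
    by_cases a4 : j2 = 0 <;> simp [a1, a2, a3, a4] <;> ring

theorem forall_momentForm_nonneg_iff {κ : ℝ} {k h l : ℕ} (hk : 2 ≤ k) (hh : 1 ≤ h) (hl : 1 ≤ l) :
    (∀ d, 0 ≤ momentForm κ h l (insert 0 (exponentsUpTo k)) d) ↔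
      0 ≤ κ ^ 2 / 2 * muntzDistSq h k + (1 - 3 / 2 * κ ^ 2) := by
  have hpos : (0 : ℝ) < h := by exact_mod_cast hh
  constructor
  · intro H
    obtain ⟨e, he0, he⟩ := exists_hilbertForm_eq_muntzDistSq hpos k
    -- The entry `-1` at `(0,1)` cancels `e 0 = 1` in the sum over `p = 0`, and `c` at `(1,1)`
    -- cancels the total sum. Neither touches the bottom row; `(1,1)` is available because `k ≥ 2`.
    set c : ℂ := 1 - ∑ n ∈ Finset.range (k + 1), e n with hc
    have := H fun i => (if i.2 = 0 then e i.1 else 0) + (if i = (0, 1) then (-1 : ℂ) else 0) +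
      if i = (1, 1) then c else 0
    rw [momentForm_eq_hilbertForm hh hl] at this
    have hm1 : (0, 1) ∈ insert 0 (exponentsUpTo k) := by
      simp [exponentsUpTo]
      omega
    have hm2 : (1, 1) ∈ insert 0 (exponentsUpTo k) := by
      simp [exponentsUpTo]
      omega
    have hA : ∑ i ∈ insert 0 (exponentsUpTo k), ((if i.2 = 0 then e i.1 else 0) +
        (if i = (0, 1) then (-1 : ℂ) else 0) + if i = (1, 1) then c else 0) = 0 := by
      rw [Finset.sum_add_distrib, Finset.sum_add_distrib, sum_row_exponents k fun i => e i.1,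
        Finset.sum_ite_eq' _ (0, 1), if_pos hm1, Finset.sum_ite_eq' _ (1, 1), if_pos hm2, hc]
      ring
    have hB : (∑ i ∈ insert 0 (exponentsUpTo k), if i.1 = 0 then ((if i.2 = 0 then e i.1 else 0) +
        (if i = (0, 1) then (-1 : ℂ) else 0) + if i = (1, 1) then c else 0) else 0) = 0 := by
      have h1 : ∀ i : ℕ × ℕ, (if i.1 = 0 then ((if i.2 = 0 then e i.1 else 0) +
          (if i = (0, 1) then (-1 : ℂ) else 0) + if i = (1, 1) then c else 0) else 0) =
          (if i = 0 then 1 else 0) + if i = (0, 1) then (-1 : ℂ) else 0 := by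
        rintro ⟨n, m⟩
        by_cases hn : n = 0 <;> by_cases hm : m = 0 <;> simp [hn, hm, Prod.ext_iff, he0]
      simp only [h1]
      rw [Finset.sum_add_distrib, Finset.sum_ite_eq', if_pos (Finset.mem_insert_self _ _),
        Finset.sum_ite_eq' _ (0, 1), if_pos hm1]
      ring
    rw [hA, hB] at this
    simp [he, he0, Prod.ext_iff] at this
    rw [← Complex.zero_le_real]
    push_cast
    exact this
  · intro H d
    rw [momentForm_eq_hilbertForm hh hl]
    have h1 := muntzDistSq_le_hilbertForm hpos k fun n => d (n, 0)
    have h2 : ∀ z : ℂ, 0 ≤ conj z * z := fun z => star_mul_self_nonneg z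
    calc (0 : ℂ) ≤ ((κ ^ 2 / 2 * muntzDistSq h k + (1 - 3 / 2 * κ ^ 2) : ℝ) : ℂ) *
          (conj (d 0) * d 0) := mul_nonneg (Complex.zero_le_real.2 H) (h2 _)
      _ = ((κ ^ 2 / 2 : ℝ) : ℂ) * ((muntzDistSq h k : ℂ) * (conj (d 0) * d 0)) +
          ((1 - 3 / 2 * κ ^ 2 : ℝ) : ℂ) * (conj (d 0) * d 0) := by
        push_cast
        ring
      _ ≤ _ := by
        refine add_le_add (mul_le_mul_of_nonneg_left ?_ ?_) le_rfl
        · exact le_add_of_nonneg_of_le (add_nonneg (h2 _) (h2 _)) h1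
        · exact Complex.zero_le_real.2 (by positivity)

/-- With only `(0,1)` free, the two squares `|A|² + |B|² = ½|A+B|² + ½|A-B|²` leave `½|d(1,0)|²`
after minimisation. Adding this to the `2 × 2` Gram form and completing the square in `d(1,0)` gives
the constant. -/
theorem forall_momentForm_one_nonneg_iff {κ : ℝ} {h l : ℕ} (hh : 1 ≤ h) (hl : 1 ≤ l) :
    (∀ d, 0 ≤ momentForm κ h l (insert 0 (exponentsUpTo 1)) d) ↔
      0 ≤ κ ^ 2 / 2 * (1 - 2 * (2 * h + 1) / (((h : ℝ) + 1) ^ 2 * (2 * h + 3))) +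
        (1 - 3 / 2 * κ ^ 2) := by
  have hE : insert 0 (exponentsUpTo 1) = {((0 : ℕ), (0 : ℕ)), (1, 0), (0, 1)} := by decide
  have n1 : (h : ℂ) + 1 ≠ 0 := by exact_mod_cast (by omega : h + 1 ≠ 0)
  have n2 : 2 * (h : ℂ) + 1 ≠ 0 := by exact_mod_cast (by omega : 2 * h + 1 ≠ 0)
  have n3 : 2 * (h : ℂ) + 3 ≠ 0 := by exact_mod_cast (by omega : 2 * h + 3 ≠ 0)
  have n4 : (h : ℂ) * 2 + 1 ≠ 0 := by rwa [mul_comm]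
  have n5 : (h : ℂ) * 2 + 3 ≠ 0 := by rwa [mul_comm]
  have h2 : ∀ z : ℂ, 0 ≤ conj z * z := fun z => star_mul_self_nonneg z
  have key : ∀ d : ℕ × ℕ → ℂ, momentForm κ h l (insert 0 (exponentsUpTo 1)) d =
      ((κ ^ 2 / 2 : ℝ) : ℂ) *
        (((1 / 2 : ℝ) : ℂ) * (conj (2 * d (0, 0) + d (1, 0) + 2 * d (0, 1)) *
            (2 * d (0, 0) + d (1, 0) + 2 * d (0, 1))) +
          (((2 * h + 3) / (2 * (2 * h + 1)) : ℝ) : ℂ) *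
          (conj (d (1, 0) + ((2 * (2 * h + 1) / ((h + 1) * (2 * h + 3)) : ℝ) : ℂ) * d (0, 0)) *
            (d (1, 0) + ((2 * (2 * h + 1) / ((h + 1) * (2 * h + 3)) : ℝ) : ℂ) * d (0, 0)))) +
      ((κ ^ 2 / 2 * (1 - 2 * (2 * h + 1) / (((h : ℝ) + 1) ^ 2 * (2 * h + 3))) +
        (1 - 3 / 2 * κ ^ 2) : ℝ) : ℂ) * (conj (d (0, 0)) * d (0, 0)) := by
    intro d
    rw [momentForm_eq_hilbertForm hh hl, hE]
    simp only [hilbertForm, Finset.sum_range_succ, Finset.sum_range_zero]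
    rw [show (0 : ℕ × ℕ) = (0, 0) from rfl]
    simp only [map_add, map_mul, Complex.conj_ofReal, map_ofNat]
    simp
    field_simp
    ring
  constructor
  · intro H
    -- The unique choice with `d(0,0) = 1` that annihilates both squares of `key`.
    have := H fun i => if i = (0, 0) then 1 else if i = (1, 0) then
      -((2 * (2 * h + 1) / ((h + 1) * (2 * h + 3)) : ℝ) : ℂ) else
      -(1 - ((2 * (2 * h + 1) / ((h + 1) * (2 * h + 3)) : ℝ) : ℂ) / 2)
    rw [key] at this
    simp only [Prod.mk.injEq, and_self, if_true, one_ne_zero, zero_ne_one, and_false, and_true,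
      if_false, mul_one, neg_add_cancel, mul_zero, add_zero, map_one] at this
    rw [← Complex.zero_le_real]
    refine this.trans_eq ?_
    ring
  · intro H d
    rw [key]
    refine add_nonneg (mul_nonneg (Complex.zero_le_real.2 (by positivity)) (add_nonneg ?_ ?_))
      (mul_nonneg (Complex.zero_le_real.2 H) (h2 _)) <;>
    exact mul_nonneg (Complex.zero_le_real.2 (by positivity)) (h2 _)

end Criterion

/-! ### Thresholds for `κ` and their monotonicity in `h`. -/

section Thresholds

/-- With `x = kh`, the recursion says `1 - b(k,h) = (1 - b(k-1,h)) (x/(x+1))²`, since `(x+1)² -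
(2x+1) = x²`. -/
theorem bSeq_eq_one_sub_muntzDistSq {h : ℝ} (hh : 0 < h) (k : ℕ) :
    bSeq (k + 1) h = 1 - muntzDistSq h (k + 1) := by
  induction k with
  | zero =>
    simp only [bSeq, muntzDistSq, zero_add, Finset.prod_range_one, Nat.cast_zero, mul_one]
    field_simp
    ring
  | succ k ih =>
    rw [bSeq, ih, muntzDistSq, muntzDistSq, Finset.prod_range_succ _ (k + 1)]
    push_cast
    rw [show (k : ℝ) + 1 + 1 = k + 2 by ring, mul_comm h, mul_assoc 2 ((k : ℝ) + 2) h]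
    have h1 : ((k : ℝ) + 2) * h ≠ 0 := by positivity
    have h2 : ((k : ℝ) + 2) * h + 1 ≠ 0 := by positivity
    generalize ((k : ℝ) + 2) * h = x at *
    field_simp
    ring

theorem muntzDistSq_lt_muntzDistSq {a b : ℝ} (ha : 0 < a) (hab : a < b) {k : ℕ} (hk : k ≠ 0) :
    muntzDistSq a k < muntzDistSq b k := by
  refine Finset.prod_lt_prod_of_nonempty (fun i _ => by positivity) (fun i _ => ?_) (by simpa)
  refine pow_lt_pow_left₀ ?_ (by positivity) two_ne_zero
  have hb : 0 < b := ha.trans hab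
  rw [div_lt_div_iff₀ (by positivity) (by positivity)]
  have : a * ((i : ℝ) + 1) < b * ((i : ℝ) + 1) := by gcongr
  nlinarith

theorem muntzDistSq_lt_one {h : ℝ} (hh : 0 < h) {k : ℕ} (hk : k ≠ 0) : muntzDistSq h k < 1 := by
  have := Finset.prod_lt_prod_of_nonempty (s := Finset.range k)
    (f := fun j : ℕ => (h * ((j : ℝ) + 1) / (h * ((j : ℝ) + 1) + 1)) ^ 2) (g := fun _ => 1)
    (fun i _ => by positivity) (fun i _ => ?_) (by simpa)
  · simpa [muntzDistSq] using this
  · refine pow_lt_one₀ (by positivity) ?_ two_ne_zero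
    rw [div_lt_one (by positivity)]
    linarith

theorem muntzDistSq_one (k : ℕ) : muntzDistSq 1 k = 1 / ((k : ℝ) + 1) ^ 2 := by
  induction k with
  | zero => simp [muntzDistSq]
  | succ k ih =>
    rw [muntzDistSq, Finset.prod_range_succ, ← muntzDistSq, ih]
    push_cast
    field_simp

theorem two_div_two_add_bSeq {h : ℝ} (hh : 0 < h) {k : ℕ} (hk : k ≠ 0) :
    2 / (2 + bSeq k h) = 2 / (3 - muntzDistSq h k) := by
  obtain ⟨k, rfl⟩ := Nat.exists_eq_succ_of_ne_zero hk
  rw [Nat.succ_eq_add_one, bSeq_eq_one_sub_muntzDistSq hh]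
  congr 1
  ring

theorem two_div_two_add_bSeq_one {k : ℕ} (hk : k ≠ 0) :
    2 / (2 + bSeq k 1) = 2 * ((k : ℝ) + 1) ^ 2 / (3 * (k : ℝ) ^ 2 + 6 * (k : ℝ) + 2) := by
  have h1 : 3 - 1 / ((k : ℝ) + 1) ^ 2 =
      (3 * (k : ℝ) ^ 2 + 6 * (k : ℝ) + 2) / ((k : ℝ) + 1) ^ 2 := by
    field_simp
    ring
  rw [two_div_two_add_bSeq one_pos hk, muntzDistSq_one, h1, div_div_eq_mul_div]

theorem two_div_two_add_bSeq_lt {a b : ℝ} (ha : 0 < a) (hab : a < b) {k : ℕ} (hk : k ≠ 0) :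
    2 / (2 + bSeq k a) < 2 / (2 + bSeq k b) := by
  have hb := ha.trans hab
  rw [two_div_two_add_bSeq ha hk, two_div_two_add_bSeq hb hk]
  have h1 := muntzDistSq_lt_muntzDistSq ha hab hk
  have h2 := muntzDistSq_lt_one hb hk
  exact div_lt_div_of_pos_left two_pos (by linarith) (by linarith)

theorem two_div_two_add_bSeq_mem {h : ℝ} (hh : 0 < h) {k : ℕ} (hk : k ≠ 0) :
    0 < 2 / (2 + bSeq k h) ∧ 2 / (2 + bSeq k h) < 1 := by
  have h1 := muntzDistSq_lt_one hh hk
  rw [two_div_two_add_bSeq hh hk]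
  exact ⟨div_pos two_pos (by linarith), (div_lt_one (by linarith)).2 (by linarith)⟩

theorem gFun_le_gFun {a b : ℝ} (ha : 0 < a) (hab : a ≤ b) : gFun a ≤ gFun b := by
  have hb := ha.trans_le hab
  obtain ⟨t, ht, rfl⟩ : ∃ t, 0 ≤ t ∧ b = a + t := ⟨b - a, by linarith, by ring⟩
  unfold gFun
  rw [div_le_div_iff₀ (by positivity) (by positivity), ← sub_nonneg]
  -- The cross-multiplied difference, factored; the denominator of `gFun` exceeds its numerator by
  -- `2h + 1`, so the high-degree terms cancel.
  have : 0 ≤ t * (8 * a ^ 3 + 20 * a ^ 2 + 14 * a + 2 +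
      (6 * a * t + 2 * t ^ 2 + 7 * t) * (2 * a + 1)) := by positivity
  linarith

theorem le_sqrt_div_iff {κ u w : ℝ} (h0 : 0 < κ) (hw : 0 < w) : κ ≤ √(u / w) ↔ κ ^ 2 * w ≤ u := by
  rw [Real.le_sqrt' h0, le_div_iff₀ hw]

theorem classH_pow_iff {κ : ℝ} (h0 : 0 < κ) (h1 : κ < 1) {k h l : ℕ} (hk : 2 ≤ k) (hh : 1 ≤ h)
    (hl : 1 ≤ l) :
    ClassH k (shiftW1 κ ^ h) (shiftW2 κ ^ l) ↔ κ ≤ √(2 / (2 + bSeq k h)) := by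
  have hpos : (0 : ℝ) < h := by exact_mod_cast hh
  have h3 := muntzDistSq_lt_one hpos (show k ≠ 0 by omega)
  rw [ClassH, and_iff_right (classH0_pow (classH0_shiftW h0 h1) h l),
    isKHyponormal_iff_momentForm h0 k hh hl, forall_momentForm_nonneg_iff hk hh hl,
    two_div_two_add_bSeq hpos (by omega), le_sqrt_div_iff h0 (by linarith)]
  constructor <;> intro H <;> linarith

theorem classH_one_pow_iff {κ : ℝ} (h0 : 0 < κ) (h1 : κ < 1) {h l : ℕ} (hh : 1 ≤ h)
    (hl : 1 ≤ l) :
    ClassH 1 (shiftW1 κ ^ h) (shiftW2 κ ^ l) ↔ κ ≤ √(gFun h) := by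
  have hpos : (0 : ℝ) < h := by exact_mod_cast hh
  rw [ClassH, and_iff_right (classH0_pow (classH0_shiftW h0 h1) h l),
    isKHyponormal_iff_momentForm h0 1 hh hl, forall_momentForm_one_nonneg_iff hh hl, gFun,
    le_sqrt_div_iff h0 (by positivity)]
  have h2 : κ ^ 2 / 2 * (1 - 2 * (2 * h + 1) / (((h : ℝ) + 1) ^ 2 * (2 * h + 3))) +
      (1 - 3 / 2 * κ ^ 2) = (2 * (h : ℝ) ^ 3 + 7 * h ^ 2 + 8 * h + 3 -
        κ ^ 2 * (2 * (h : ℝ) ^ 3 + 7 * h ^ 2 + 10 * h + 4)) /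
          (((h : ℝ) + 1) ^ 2 * (2 * h + 3)) := by
    field_simp
    ring
  rw [h2, le_div_iff₀ (by positivity), zero_mul, sub_nonneg]

theorem classH_one_iff {κ : ℝ} (h0 : 0 < κ) (h1 : κ < 1) :
    ClassH 1 (shiftW1 κ) (shiftW2 κ) ↔ κ ≤ √(20 / 23) := by
  have := classH_one_pow_iff h0 h1 (le_refl 1) (le_refl 1)
  rw [pow_one, pow_one] at this
  rw [this]
  norm_num [gFun]

theorem classH_iff {κ : ℝ} (h0 : 0 < κ) (h1 : κ < 1) {k : ℕ} (hk : 2 ≤ k) :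
    ClassH k (shiftW1 κ) (shiftW2 κ) ↔
      κ ≤ √(2 * ((k : ℝ) + 1) ^ 2 / (3 * (k : ℝ) ^ 2 + 6 * (k : ℝ) + 2)) := by
  have := classH_pow_iff h0 h1 hk (le_refl 1) (le_refl 1)
  rwa [pow_one, pow_one, Nat.cast_one, two_div_two_add_bSeq_one (by omega)] at this

end Thresholds

/-! ### The comparison of the pair with its powers. -/

theorem theorem5p1 :
    (∀ κ : ℝ, 0 < κ → κ < 1 →
      -- `k = 1`: all powers simultaneously
      (((∀ h ℓ : ℕ, 2 ≤ h → 1 ≤ ℓ → ClassH 1 (shiftW1 κ ^ h) (shiftW2 κ ^ ℓ)) ∧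
            ¬ ClassH 1 (shiftW1 κ) (shiftW2 κ)) ↔
          (√(20 / 23) < κ ∧ κ ≤ √(63 / 68))) ∧
      -- `k = 1`: each power separately
      (∀ h ℓ : ℕ, 2 ≤ h → 1 ≤ ℓ →
        ((ClassH 1 (shiftW1 κ ^ h) (shiftW2 κ ^ ℓ) ∧ ¬ ClassH 1 (shiftW1 κ) (shiftW2 κ)) ↔
          (√(20 / 23) < κ ∧ κ ≤ √(gFun h)))) ∧
      -- `k ≥ 2`
      (∀ k h ℓ : ℕ, 2 ≤ k → 2 ≤ h → 1 ≤ ℓ →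
        ((ClassH k (shiftW1 κ ^ h) (shiftW2 κ ^ ℓ) ∧ ¬ ClassH k (shiftW1 κ) (shiftW2 κ)) ↔
          (√(2 * ((k : ℝ) + 1) ^ 2 / (3 * (k : ℝ) ^ 2 + 6 * (k : ℝ) + 2)) < κ ∧
            κ ≤ √(2 / (2 + bSeq k h)))))) ∧
    -- for every `k`, all powers with `h ≥ 2` may be `k`-hyponormal while the pair itself is not
    (∀ k : ℕ, 1 ≤ k → ∃ κ : ℝ, 0 < κ ∧ κ < 1 ∧
      ClassH0 (shiftW1 κ) (shiftW2 κ) ∧ ¬ ClassH k (shiftW1 κ) (shiftW2 κ) ∧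
      ∀ h ℓ : ℕ, 2 ≤ h → 1 ≤ ℓ → ClassH k (shiftW1 κ ^ h) (shiftW2 κ ^ ℓ)) := by
  have hg2 : gFun (2 : ℕ) = 63 / 68 := by norm_num [gFun]
  have hg : ∀ h : ℕ, 2 ≤ h → √(63 / 68) ≤ √(gFun h) := fun h hh => by
    rw [← hg2]
    exact Real.sqrt_le_sqrt (gFun_le_gFun (by norm_num) (by exact_mod_cast hh))
  refine ⟨fun κ h0 h1 => ⟨?_, ?_, ?_⟩, fun k hk => ?_⟩
  · rw [classH_one_iff h0 h1, not_le, and_comm]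
    refine and_congr_right fun _ => ⟨fun H => ?_, fun H h l hh hl => ?_⟩
    -- The power `h = 2` is the most restrictive one, since `gFun` increases with `h`.
    · have := (classH_one_pow_iff h0 h1 one_le_two le_rfl).1 (H 2 1 le_rfl le_rfl)
      rwa [hg2] at this
    · exact (classH_one_pow_iff h0 h1 (by omega) hl).2 (H.trans (hg h hh))
  · intro h l hh hl
    rw [classH_one_iff h0 h1, not_le, and_comm, classH_one_pow_iff h0 h1 (by omega) hl]
  · intro k h l hk hh hl
    rw [classH_iff h0 h1 hk, not_le, and_comm, classH_pow_iff h0 h1 hk (by omega) hl]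
  · rcases hk.eq_or_lt with rfl | hk
    · have h0 : (0 : ℝ) < √(63 / 68) := Real.sqrt_pos.2 (by norm_num)
      have h1 : √(63 / 68 : ℝ) < 1 := (Real.sqrt_lt' one_pos).2 (by norm_num)
      refine ⟨√(63 / 68), h0, h1, classH0_shiftW h0 h1, ?_, fun h l hh hl => ?_⟩
      · rw [classH_one_iff h0 h1, not_le]
        exact Real.sqrt_lt_sqrt (by norm_num) (by norm_num)
      · exact (classH_one_pow_iff h0 h1 (by omega) hl).2 (hg h hh)
    · have hk0 : k ≠ 0 := by omega
      obtain ⟨hb0, hb1⟩ := two_div_two_add_bSeq_mem two_pos hk0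
      have h0 := Real.sqrt_pos.2 hb0
      have h1 : √(2 / (2 + bSeq k 2)) < 1 := (Real.sqrt_lt' one_pos).2 (by simpa using hb1)
      -- The threshold for `h = 2`: admissible for every larger `h`, and strictly above the
      -- threshold for `h = 1`, which is that of `W`.
      refine ⟨√(2 / (2 + bSeq k 2)), h0, h1, classH0_shiftW h0 h1, ?_, fun h l hh hl => ?_⟩
      · rw [classH_iff h0 h1 hk, not_le, ← two_div_two_add_bSeq_one hk0]
        exact Real.sqrt_lt_sqrt (two_div_two_add_bSeq_mem one_pos hk0).1.le
          (two_div_two_add_bSeq_lt one_pos one_lt_two hk0)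
      · refine (classH_pow_iff h0 h1 hk (by omega) hl).2 (Real.sqrt_le_sqrt ?_)
        rcases hh.eq_or_lt with rfl | hh
        · simp
        · exact (two_div_two_add_bSeq_lt two_pos (by exact_mod_cast hh) hk0).le
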